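/- Let $n\ge 2$, $d\ge 1$ be integers and $\lambda>0$. Call a matrix $A\in[0,1]^{n\times d}$ isotonic if its columns are nondecreasing, and write $\mathbb C_{\mathrm{iso}}$ for the set of these matrices. For a permutation $\pi$ of $[n]$ and $M\in\mathbb R^{n\times d}$ let $(M_{\pi^{-1}})_{i,k}=M_{\pi^{-1}(i),k}$. The unknown parameters are a permutation $\pi^*$ of $[n]$ and a matrix $M$ with $M_{\pi^{*-1}}\in\mathbb C_{\mathrm{iso}}$. One observes $N\sim\mathrm{Poisson}(\lambda nd)$ pairs $(x_t,y_t)$, independent given $N$, where $x_t$ is uniform on $[n]\times[d]$ and $y_t=M_{x_t}+\varepsilon_t$; given $x_t$, the noise $\varepsilon_t$ has a law that depends only on the position $x_t$, is centered, and is sub-Gaussian with parameter at most $1$, i.e. $\mathbb E[e^{s\varepsilon_t}\mid x_t]\le e^{s^2/2}$ for all real $s$. The minimax permutation risk is $$\mathcal R^*_{\mathrm{perm}}(n,d,\lambda)=\inf_{\hat\pi}\ \sup\ \mathbb E\big[\|M_{\hat\pi^{-1}}-M_{\pi^{*-1}}\|_F^2\big],$$ where the infimum is over all (possibly randomized) estimators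 $\hat\pi$, i.e. measurable functions of the data and of independent randomness with values in the permutations of $[n]$, and the supremum is over all $(\pi^*,M)$ as above and all admissible noise laws. Let $$\rho_{\mathrm{perm}}(n,d,\lambda)=\min\Big(\frac{n^{2/3}\sqrt d}{\lambda^{5/6}},\ n\sqrt{\frac d\lambda}\Big)+\frac n\lambda .$$ **Theorem.** There is a universal constant $c>0$ such that for all integers $n\ge2$, $d\ge1$ and all $\lambda\in[1/d,\,8n^2]$, $$\mathcal R^*_{\mathrm{perm}}(n,d,\lambda)\ \ge\ c\,\rho_{\mathrm{perm}}(n,d,\lambda).$$ The same bound holds, with the same $c$, for the minimax risk in which all noise laws are fixed to be standard Gaussian and the supremum is only over $(\pi^*,M)$. -/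

import Mathlib

open MeasureTheory ProbabilityTheory
open scoped NNReal ENNReal

namespace IsoPerm

/-- Isotonic matrices: `n × d` matrices with entries in `[0,1]` and nondecreasing columns. -/
def isotonic (n d : ℕ) : Set (Matrix (Fin n) (Fin d) ℝ) :=
  {A | (∀ i k, A i k ∈ Set.Icc (0 : ℝ) 1) ∧ ∀ k, Monotone fun i => A i k}

/-- The matrix `M_{π⁻¹}`, whose `(i,k)` entry is `M (π⁻¹ i) k`. -/
def permRows {n d : ℕ} (M : Matrix (Fin n) (Fin d) ℝ) (π : Equiv.Perm (Fin n)) :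
    Matrix (Fin n) (Fin d) ℝ :=
  fun i k => M (π.symm i) k

/-- A noise family: the law of the noise at each position `(i,k)`. -/
abbrev NoiseFamily (n d : ℕ) : Type := Fin n × Fin d → Measure ℝ

/-- Noise families all of whose laws are centered and sub-Gaussian with parameter at most `1`,
i.e. `E[exp (t ε)] ≤ exp (t² / 2)` for all real `t`. -/
def subGaussianNoise (n d : ℕ) : Set (NoiseFamily n d) :=
  {ν | ∀ x, IsProbabilityMeasure (ν x) ∧ ∫ e, e ∂(ν x) = 0 ∧ HasSubgaussianMGF id 1 (ν x)}

/-- The single noise family with a standard Gaussian law at every position. -/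
noncomputable def gaussianNoise (n d : ℕ) : Set (NoiseFamily n d) :=
  {fun _ => gaussianReal 0 1}

/-- The unknown parameters of the isotonic model for a given class of noise families: an oracle
permutation `π*`, a signal matrix `M` with `M_{π*⁻¹}` isotonic, and the laws of the noise. -/
structure Param (n d : ℕ) (𝒩 : Set (NoiseFamily n d)) where
  perm : Equiv.Perm (Fin n)
  signal : Matrix (Fin n) (Fin d) ℝ
  noise : NoiseFamily n d
  isotonic_permRows : permRows signal perm ∈ isotonic n d
  noise_mem : noise ∈ 𝒩

instance (n d : ℕ) (𝒩 : Set (NoiseFamily n d)) : MeasurableSpace (Param n d 𝒩) := ⊤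

instance (n : ℕ) : MeasurableSpace (Equiv.Perm (Fin n)) := ⊤

/-- The law of one observation `(x, y)`: the position `x` is uniform on `[n] × [d]` and, given `x`,
`y = M_x + ε` where `ε` has the noise law at position `x`. -/
noncomputable def singleObs {n d : ℕ} (M : Matrix (Fin n) (Fin d) ℝ) (ν : NoiseFamily n d) :
    Measure ((Fin n × Fin d) × ℝ) :=
  (uniformOn (Set.univ : Set (Fin n × Fin d))).bind
    fun x => (ν x).map fun e => (x, M x.1 x.2 + e)

/-- A data set: a number `N` of observations, and `N` pairs `(x_t, y_t)`. -/
abbrev Data (n d : ℕ) : Type := Σ N : ℕ, Fin N → (Fin n × Fin d) × ℝ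

/-- The law of the data: `N` is Poisson with parameter `lam * n * d` and, given `N`, the `N`
observations are independent and identically distributed as `singleObs`. -/
noncomputable def dataLaw {n d : ℕ} (lam : ℝ) (M : Matrix (Fin n) (Fin d) ℝ)
    (ν : NoiseFamily n d) : Measure (Data n d) :=
  (poissonMeasure (lam * n * d).toNNReal).bind
    fun N => (Measure.pi fun _ : Fin N => singleObs M ν).map (Sigma.mk N)

/-- The law of the data, as a function of the unknown parameters. -/
noncomputable def model (n d : ℕ) (lam : ℝ) (𝒩 : Set (NoiseFamily n d)) :
    Kernel (Param n d 𝒩) (Data n d) where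
  toFun θ := dataLaw lam θ.signal θ.noise
  measurable' := measurable_from_top

/-- The loss `‖M_{π⁻¹} - M_{π*⁻¹}‖²` (squared Frobenius norm) of an estimate `π`. -/
noncomputable def permLoss {n d : ℕ} {𝒩 : Set (NoiseFamily n d)} (θ : Param n d 𝒩)
    (π : Equiv.Perm (Fin n)) : ℝ≥0∞ :=
  ENNReal.ofReal
    (∑ i, ∑ k, (permRows θ.signal π i k - permRows θ.signal θ.perm i k) ^ 2)

/-- The minimax risk of permutation estimation: infimum over all (possibly randomized) estimators
of the supremum over the unknown parameters of the expected loss. -/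
noncomputable def riskPerm (n d : ℕ) (lam : ℝ) (𝒩 : Set (NoiseFamily n d)) : ℝ≥0∞ :=
  minimaxRisk (permLoss (n := n) (d := d) (𝒩 := 𝒩)) (model n d lam 𝒩)

/-- The rate `(n^{2/3} √d / λ^{5/6} ∧ n √(d/λ)) + n/λ`. -/
noncomputable def rhoPerm (n d : ℕ) (lam : ℝ) : ℝ :=
  min ((n : ℝ) ^ (2 / 3 : ℝ) * √(d : ℝ) / lam ^ (5 / 6 : ℝ)) ((n : ℝ) * √((d : ℝ) / lam))
    + (n : ℝ) / lam

end IsoPerm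

namespace IsoPerm

/-! ### Densities of product measures. -/

section

/-! The lower bound is Bayesian. Cut the rows into consecutive groups of `2 * m`, with `m` low
positions followed by `m` high ones. Group `g` has base level `2 * δ * g`; in each block (group,
column) the high positions are raised by `δ` if the block is active. Blocks are active independently
with probability `q`. Low and high rows are paired within groups, and uniform random bits `σ` decide
which pairs are exchanged. A paired row put at a position of the wrong type costs at least `δ ^ 2`
in every active column of its group, so it remains to show that each bit is hard to guess.

Fix a paired row and one of its columns, and condition on that block being active. Relative to the
unraised matrix, the data have a density which, averaged over the other blocks, is a product over
blocks of factors `1 - q + q * L`, with `L` itself in the known block. Poisson sampling makes the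
blocks independent, so Hellinger affinities multiply. Flipping the bit changes only the `d` blocks
of one group. The known block loses at most `lam * δ ^ 2 / 4` of affinity. A mixed block loses at
most about `q ^ 2 * 𝔼 (L - L') ^ 2`, which is of order `q ^ 2 * lam * δ ^ 2` provided that `m * lam
* δ ^ 2` is bounded. The bit therefore stays undetectable for `q` of order `1 / (δ * √(lam * d))`,
and the risk is at least of order `n * d * q * δ ^ 2`, that is, `n * δ * √(d / lam)`.

Entries must stay in `[0,1]` with `n / (2 * m)` groups, so `δ` is at most of order `m / n`. Together
with `m * lam * δ ^ 2 ≲ 1` this gives `δ` of order `v = min ((n * lam) ^ (-1/3)) 1` and `m` of order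
`n * v`, hence the first term of the rate. The term `n / lam` comes from `q = 1`, `m = n / 2` and
`δ` of order `1 / √(d * lam)`.

The argument is carried by `iIndepFun_sampleSum` (independence of blocks), `test_error_lower_bound`
(affinity to testing error), `integral_sqrt_mix_mul_ge` (affinity of mixed blocks) and
`RowDesign.riskPerm_ge` (Bayes bound for a design). -/

theorem measurable_of_forall_sigmaMk {ι β : Type*} {α : ι → Type*}
    [∀ i, MeasurableSpace (α i)] [MeasurableSpace β] {f : (Σ i, α i) → β}
    (hf : ∀ i, Measurable fun x : α i => f ⟨i, x⟩) : Measurable f := by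
  intro s hs
  refine MeasurableSpace.measurableSet_iInf.2 fun i => ?_
  exact hf i hs

theorem measurable_sigmaMk {ι : Type*} {α : ι → Type*}
    [∀ i, MeasurableSpace (α i)] (i : ι) : Measurable (Sigma.mk (β := α) i) := by
  intro s hs
  exact MeasurableSpace.measurableSet_iInf.1 hs i

theorem lintegral_pi_prod {ι E : Type*} [Fintype ι] [MeasurableSpace E] (Q : Measure E)
    [IsProbabilityMeasure Q] {g : ι → E → ℝ≥0∞} (hg : ∀ i, Measurable (g i)) :
    ∫⁻ x : ι → E, ∏ i, g i (x i) ∂(Measure.pi fun _ => Q) = ∏ i, ∫⁻ e, g i e ∂Q := by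
  have hind : iIndepFun (fun (i : ι) (x : ι → E) => g i (x i)) (Measure.pi fun _ : ι => Q) :=
    iIndepFun_pi fun i => (hg i).aemeasurable
  rw [lintegral_prod_eq_prod_lintegral_of_indepFun _ _ hind
    fun i => (hg i).comp (measurable_pi_apply i)]
  refine Finset.prod_congr rfl fun i _ => ?_
  exact (measurePreserving_eval (fun _ : ι => Q) i).lintegral_comp (hg i)

theorem pi_withDensity {ι E : Type*} [Fintype ι] [MeasurableSpace E] (Q : Measure E)
    [IsProbabilityMeasure Q] {l : E → ℝ≥0∞} (hl : Measurable l)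
    [IsProbabilityMeasure (Q.withDensity l)] :
    Measure.pi (fun _ : ι => Q.withDensity l)
      = (Measure.pi fun _ : ι => Q).withDensity fun x => ∏ i, l (x i) := by
  refine Measure.pi_eq fun s hs => ?_
  rw [withDensity_apply _ (MeasurableSet.univ_pi hs),
    ← lintegral_indicator (MeasurableSet.univ_pi hs)]
  have : (fun x : ι → E => (Set.univ.pi s).indicator (fun x => ∏ i, l (x i)) x)
      = fun x => ∏ i, (s i).indicator l (x i) := by
    funext x
    by_cases hx : x ∈ Set.univ.pi s
    · rw [Set.indicator_of_mem hx]
      exact Finset.prod_congr rfl fun i _ => (Set.indicator_of_mem (hx i (Set.mem_univ i)) _).symm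
    · rw [Set.indicator_of_notMem hx]
      simp only [Set.mem_pi, Set.mem_univ, true_implies, not_forall] at hx
      obtain ⟨i, hi⟩ := hx
      exact (Finset.prod_eq_zero (Finset.mem_univ i) (Set.indicator_of_notMem hi _)).symm
  rw [this, lintegral_pi_prod Q fun i => hl.indicator (hs i)]
  refine Finset.prod_congr rfl fun i _ => ?_
  rw [withDensity_apply _ (hs i), lintegral_indicator (hs i)]

/-! ### Poisson samples: densities, Campbell's formula, independence of classes. -/

section PoissonSample

variable {E : Type*} [MeasurableSpace E]

/-- The law of a sample of Poisson size `r` from the distribution `Q`. -/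
noncomputable def poissonSample (r : ℝ≥0) (Q : Measure E) : Measure (Σ N : ℕ, Fin N → E) :=
  (poissonMeasure r).bind fun N => (Measure.pi fun _ : Fin N => Q).map (Sigma.mk N)

theorem poissonSample_eq_sum (r : ℝ≥0) (Q : Measure E) :
    poissonSample r Q = Measure.sum fun N : ℕ =>
      ENNReal.ofReal (Real.exp (-r) * r ^ N / N.factorial) •
        (Measure.pi fun _ : Fin N => Q).map (Sigma.mk N) := by
  have hm : Measurable fun N : ℕ => (Measure.pi fun _ : Fin N => Q).map
    (Sigma.mk (β := fun N => Fin N → E) N) := measurable_from_top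
  rw [poissonSample, poissonMeasure, Measure.bind_sum _ _ hm.aemeasurable]
  congr 1
  funext N
  rw [Measure.bind_smul, Measure.dirac_bind hm]

theorem lintegral_poissonSample (r : ℝ≥0) (Q : Measure E) {g : (Σ N : ℕ, Fin N → E) → ℝ≥0∞}
    (hg : Measurable g) :
    ∫⁻ D, g D ∂(poissonSample r Q) = ∑' N : ℕ,
      ENNReal.ofReal (Real.exp (-r) * r ^ N / N.factorial) *
        ∫⁻ x, g ⟨N, x⟩ ∂(Measure.pi fun _ : Fin N => Q) := by
  rw [poissonSample_eq_sum, lintegral_sum_measure]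
  refine tsum_congr fun N => ?_
  rw [lintegral_smul_measure, lintegral_map hg (measurable_sigmaMk N), smul_eq_mul]

theorem measurable_sampleProd {M : Type*} [CommMonoid M] [MeasurableSpace M] [MeasurableMul₂ M]
    {φ : E → M} (hφ : Measurable φ) :
    Measurable fun D : (Σ N : ℕ, Fin N → E) => ∏ t, φ (D.2 t) := by
  refine measurable_of_forall_sigmaMk fun N => ?_
  exact Finset.measurable_fun_prod Finset.univ
    fun t _ => hφ.comp (measurable_pi_apply (X := fun _ : Fin N => E) t)

theorem measurable_sampleSum {M : Type*} [AddCommMonoid M] [MeasurableSpace M] [MeasurableAdd₂ M]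
    {φ : E → M} (hφ : Measurable φ) :
    Measurable fun D : (Σ N : ℕ, Fin N → E) => ∑ t, φ (D.2 t) := by
  refine measurable_of_forall_sigmaMk fun N => ?_
  exact Finset.measurable_fun_sum Finset.univ
    fun t _ => hφ.comp (measurable_pi_apply (X := fun _ : Fin N => E) t)

instance (r : ℝ≥0) (Q : Measure E) [IsProbabilityMeasure Q] :
    IsProbabilityMeasure (poissonSample r Q) := by
  refine isProbabilityMeasure_bind ?_ (Filter.Eventually.of_forall fun N => ?_)
  · exact (measurable_from_top).aemeasurable
  · exact Measure.isProbabilityMeasure_map (measurable_sigmaMk N).aemeasurable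

theorem poissonSample_withDensity (r : ℝ≥0) (Q : Measure E) [IsProbabilityMeasure Q]
    {l : E → ℝ≥0∞} (hl : Measurable l) [IsProbabilityMeasure (Q.withDensity l)] :
    poissonSample r (Q.withDensity l)
      = (poissonSample r Q).withDensity fun D => ∏ t, l (D.2 t) := by
  refine Measure.ext_of_lintegral _ fun g hg => ?_
  rw [lintegral_withDensity_eq_lintegral_mul _ (measurable_sampleProd hl) hg,
    lintegral_poissonSample _ _ hg,
    lintegral_poissonSample _ _ ((measurable_sampleProd hl).mul hg)]
  refine tsum_congr fun N => ?_
  rw [pi_withDensity Q hl, lintegral_withDensity_eq_lintegral_mul]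
  · rfl
  · exact Finset.measurable_fun_prod _ fun t _ => hl.comp (measurable_pi_apply t)
  · exact hg.comp (measurable_sigmaMk N)

/-- Campbell's formula, integrability part. -/
theorem integrable_sampleProd {𝕜 : Type*} [RCLike 𝕜] (r : ℝ≥0) (Q : Measure E)
    [IsProbabilityMeasure Q] {φ : E → 𝕜} (hφ : Measurable φ) (hi : Integrable φ Q) :
    Integrable (fun D => ∏ t, φ (D.2 t)) (poissonSample r Q) := by
  have hm : Measurable fun D : (Σ N : ℕ, Fin N → E) => ∏ t, φ (D.2 t) := measurable_sampleProd hφ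
  refine ⟨hm.aestronglyMeasurable, ?_⟩
  rw [hasFiniteIntegral_iff_enorm, lintegral_poissonSample _ _ hm.enorm]
  have hfin : ∫⁻ e, ‖φ e‖ₑ ∂Q ≠ ∞ := hi.2.ne
  lift ∫⁻ e, ‖φ e‖ₑ ∂Q to ℝ≥0 using hfin with a ha
  have hterm : ∀ N : ℕ, ENNReal.ofReal (Real.exp (-r) * r ^ N / N.factorial) *
      ∫⁻ x, ‖∏ t, φ (x t)‖ₑ ∂(Measure.pi fun _ : Fin N => Q)
      = ENNReal.ofReal (Real.exp (-r) * ((r * a : ℝ) ^ N / N.factorial)) := by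
    intro N
    have h1 : (fun x : Fin N → E => ‖∏ t, φ (x t)‖ₑ) = fun x => ∏ t, ‖φ (x t)‖ₑ := by
      funext x
      simp [enorm, nnnorm_prod]
    rw [h1, lintegral_pi_prod Q (g := fun _ e => ‖φ e‖ₑ) fun _ => hφ.enorm, Finset.prod_const,
      ← ha, Finset.card_univ, Fintype.card_fin, ← ENNReal.ofReal_coe_nnreal,
      ← ENNReal.ofReal_pow a.coe_nonneg, ← ENNReal.ofReal_mul (by positivity)]
    congr 1
    rw [mul_pow]
    ring
  have hs : Summable fun N : ℕ => Real.exp (-r) * ((r * a : ℝ) ^ N / N.factorial) :=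
    (Real.summable_pow_div_factorial _).mul_left _
  have := hs.tsum_ofReal_lt_top
  simpa only [hterm] using this

/-- Campbell's formula for multiplicative functionals. -/
theorem integral_sampleProd_complex (r : ℝ≥0) (Q : Measure E)
    [IsProbabilityMeasure Q] {φ : E → ℂ} (hφ : Measurable φ) (hi : Integrable φ Q) :
    ∫ D : (Σ N : ℕ, Fin N → E), ∏ t, φ (D.2 t) ∂(poissonSample r Q)
      = Complex.exp (((r : ℝ) : ℂ) * (∫ e, φ e ∂Q - 1)) := by
  have hm : Measurable fun D : (Σ N : ℕ, Fin N → E) => ∏ t, φ (D.2 t) := measurable_sampleProd hφ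
  have hint := integrable_sampleProd r Q hφ hi
  rw [poissonSample_eq_sum] at hint ⊢
  rw [integral_sum_measure hint]
  set a := ∫ e, φ e ∂Q with ha
  have hterm : ∀ N : ℕ, ∫ D : (Σ N : ℕ, Fin N → E), ∏ t, φ (D.2 t) ∂(ENNReal.ofReal (Real.exp (-r) * r ^ N / N.factorial) •
        (Measure.pi fun _ : Fin N => Q).map (Sigma.mk (β := fun N => Fin N → E) N))
      = Complex.exp (-((r : ℝ) : ℂ)) * ((((r : ℝ) : ℂ) * a) ^ N / N.factorial) := by
    intro N
    rw [integral_smul_measure, integral_map (measurable_sigmaMk N).aemeasurable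
      hm.aestronglyMeasurable, ENNReal.toReal_ofReal (by positivity)]
    have := integral_fintype_prod_eq_pow (ι := Fin N) (μ := Q) φ
    simp only [Fintype.card_fin] at this
    rw [this, ← ha, Complex.real_smul]
    push_cast
    rw [mul_pow]
    ring
  simp only [hterm]
  rw [((NormedSpace.expSeries_div_hasSum_exp (((r : ℝ) : ℂ) * a)).mul_left _).tsum_eq,
    ← Complex.exp_eq_exp_ℂ, ← Complex.exp_add]
  congr 1
  ring

theorem integral_sampleProd (r : ℝ≥0) (Q : Measure E)
    [IsProbabilityMeasure Q] {φ : E → ℝ} (hφ : Measurable φ) (hi : Integrable φ Q) :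
    ∫ D : (Σ N : ℕ, Fin N → E), ∏ t, φ (D.2 t) ∂(poissonSample r Q)
      = Real.exp (r * (∫ e, φ e ∂Q - 1)) := by
  have h := integral_sampleProd_complex r Q (φ := fun e => (φ e : ℂ)) (by fun_prop) hi.ofReal
  rw [integral_complex_ofReal] at h
  have h2 : (fun D : (Σ N : ℕ, Fin N → E) => ∏ t, (φ (D.2 t) : ℂ))
      = fun D => ((∏ t, φ (D.2 t) : ℝ) : ℂ) := by
    funext D
    push_cast
    rfl
  rw [h2, integral_complex_ofReal] at h
  exact_mod_cast h

/-- The components of a Poisson sample that fall into different classes are independent. -/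
theorem iIndepFun_sampleSum {C V : Type*} [Fintype C] [DecidableEq C] [NormedAddCommGroup V]
    [InnerProductSpace ℝ V] [CompleteSpace V] [MeasurableSpace V] [BorelSpace V]
    [SecondCountableTopology V] (r : ℝ≥0) (Q : Measure E) [IsProbabilityMeasure Q]
    [MeasurableSpace C] [MeasurableSingletonClass C] {c : E → C} (hc : Measurable c)
    {ψ : E → V} (hψ : Measurable ψ) :
    iIndepFun (fun (a : C) (D : Σ N : ℕ, Fin N → E) => ∑ t, if c (D.2 t) = a then ψ (D.2 t) else 0)
      (poissonSample r Q) := by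
  have hmeas : ∀ a : C, Measurable fun e => if c e = a then ψ e else 0 := fun a =>
    Measurable.ite (hc (measurableSet_singleton a)) hψ measurable_const
  have hT : ∀ a : C, Measurable fun D : (Σ N : ℕ, Fin N → E) =>
      ∑ t, if c (D.2 t) = a then ψ (D.2 t) else 0 := fun a => measurable_sampleSum (hmeas a)
  rw [iIndepFun_iff_charFun_pi fun a => (hT a).aemeasurable]
  intro τ
  have hbdd : ∀ (f : E → ℝ), Measurable f →
      Integrable (fun e => Complex.exp (f e * Complex.I)) Q := by
    intro f hf
    refine Integrable.of_bound (by fun_prop) 1 (Filter.Eventually.of_forall fun e => ?_)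
    rw [Complex.norm_exp_ofReal_mul_I]
  have key : ∀ (f : E → ℝ), Measurable f →
      ∫ D : (Σ N : ℕ, Fin N → E), Complex.exp ((∑ t, f (D.2 t) : ℝ) * Complex.I)
        ∂(poissonSample r Q)
      = Complex.exp ((r : ℝ) * ∫ e, (Complex.exp (f e * Complex.I) - 1) ∂Q) := by
    intro f hf
    rw [integral_sub (hbdd f hf) (integrable_const _), integral_const, probReal_univ, one_smul,
      ← integral_sampleProd_complex r Q (by fun_prop) (hbdd f hf)]
    congr 1
    funext D
    rw [← Complex.exp_sum, ← Finset.sum_mul]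
    push_cast
    rfl
  have hone : ∀ a : C, Measurable fun e => (inner ℝ (if c e = a then ψ e else 0) (τ a) : ℝ) :=
    fun a => (hmeas a).inner_const
  have h1 : ∀ a : C, charFun ((poissonSample r Q).map fun D : (Σ N : ℕ, Fin N → E) =>
      ∑ t, if c (D.2 t) = a then ψ (D.2 t) else 0) (τ a)
      = Complex.exp ((r : ℝ) * ∫ e, (Complex.exp
        ((inner ℝ (if c e = a then ψ e else 0) (τ a) : ℝ) * Complex.I) - 1) ∂Q) := by
    intro a
    rw [charFun_apply, integral_map (hT a).aemeasurable (by fun_prop), ← key _ (hone a)]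
    simp only [sum_inner]
  have hfull : Measurable fun e =>
      (∑ a : C, inner ℝ (if c e = a then ψ e else 0) (τ a) : ℝ) :=
    Finset.measurable_fun_sum _ fun a _ => hone a
  have h2 : charFun ((poissonSample r Q).map fun D : (Σ N : ℕ, Fin N → E) =>
      WithLp.toLp 2 fun a : C => ∑ t, if c (D.2 t) = a then ψ (D.2 t) else 0) τ
      = Complex.exp ((r : ℝ) * ∫ e, (Complex.exp
        ((∑ a : C, inner ℝ (if c e = a then ψ e else 0) (τ a) : ℝ) * Complex.I) - 1) ∂Q) := by
    have hm : Measurable fun D : (Σ N : ℕ, Fin N → E) =>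
        WithLp.toLp 2 fun a : C => ∑ t, if c (D.2 t) = a then ψ (D.2 t) else 0 :=
      (WithLp.measurable_toLp 2 _).comp (measurable_pi_lambda _ hT)
    rw [charFun_apply, integral_map hm.aemeasurable (by fun_prop), ← key _ hfull]
    simp only [PiLp.inner_apply, sum_inner]
    congr 1
    funext D
    rw [Finset.sum_comm]
  rw [h2]
  simp only [h1]
  rw [← Complex.exp_sum, ← Finset.mul_sum, ← integral_finsetSum]
  -- At a given point only the class `c e` contributes, so `exp (∑ …) - 1 = ∑ (exp … - 1)`. This
  -- additivity in the Campbell exponent is the independence.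
  · congr 3
    funext e
    rw [Finset.sum_eq_single (c e) (fun b _ hb => by simp [Ne.symm hb]) (by simp),
      Finset.sum_eq_single (c e) (fun b _ hb => by simp [Ne.symm hb]) (by simp)]
  · exact fun a _ => (hbdd _ (hone a)).sub (integrable_const _)

end PoissonSample

end

/-! ### Likelihood ratios of the Gaussian model. -/

section

theorem gaussianReal_eq_withDensity (m a : ℝ) :
    gaussianReal (m + a) 1
      = (gaussianReal m 1).withDensity fun y => ENNReal.ofReal (Real.exp (a * (y - m) - a ^ 2 / 2)) := by
  rw [gaussianReal_of_var_ne_zero _ one_ne_zero, gaussianReal_of_var_ne_zero _ one_ne_zero,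
    ← withDensity_mul _ (measurable_gaussianPDF _ _) (by fun_prop)]
  congr 1
  funext y
  simp only [Pi.mul_apply, gaussianPDF, gaussianPDFReal]
  rw [← ENNReal.ofReal_mul (by positivity)]
  conv_rhs => rw [mul_assoc, ← Real.exp_add]
  congr 3
  push_cast
  ring

theorem integrable_exp_tilt_gaussianReal (m δ v : ℝ) :
    Integrable (fun y => Real.exp (v * (δ * (y - m) - δ ^ 2 / 2))) (gaussianReal m 1) := by
  have h := (integrable_exp_mul_gaussianReal (μ := m) (v := 1) (v * δ)).const_mul
    (Real.exp (-(v * δ * m) - v * δ ^ 2 / 2))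
  refine h.congr (Filter.Eventually.of_forall fun y => ?_)
  simp only [← Real.exp_add]
  congr 1
  ring

theorem integral_exp_tilt_gaussianReal (m δ v : ℝ) :
    ∫ y, Real.exp (v * (δ * (y - m) - δ ^ 2 / 2)) ∂(gaussianReal m 1)
      = Real.exp (δ ^ 2 * (v ^ 2 - v) / 2) := by
  have h := congrFun (mgf_fun_id_gaussianReal (μ := m) (v := 1)) (v * δ)
  rw [mgf] at h
  have h2 : ∀ y : ℝ, Real.exp (v * (δ * (y - m) - δ ^ 2 / 2))
      = Real.exp (-(v * δ * m) - v * δ ^ 2 / 2) * Real.exp (v * δ * y) := by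
    intro y
    rw [← Real.exp_add]
    congr 1
    ring
  simp only [h2]
  rw [integral_const_mul, h, ← Real.exp_add]
  congr 1
  push_cast
  ring

variable {n d : ℕ}

/-- The standard Gaussian noise family. -/
noncomputable abbrev stdNoise (n d : ℕ) : NoiseFamily n d := fun _ => gaussianReal 0 1

theorem singleObs_stdNoise (M : Matrix (Fin n) (Fin d) ℝ) :
    singleObs M (stdNoise n d) = ∑ x : Fin n × Fin d,
      ((n * d : ℝ≥0∞)⁻¹) • (gaussianReal (M x.1 x.2) 1).map (Prod.mk x) := by
  refine Measure.ext_of_lintegral _ fun h hh => ?_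
  rw [singleObs, Measure.lintegral_bind (measurable_of_finite _).aemeasurable hh.aemeasurable,
    lintegral_fintype, lintegral_finsetSum_measure]
  refine Finset.sum_congr rfl fun x _ => ?_
  rw [lintegral_smul_measure, lintegral_map hh (by fun_prop), lintegral_map hh (by fun_prop),
    smul_eq_mul, mul_comm]
  congr 1
  · rw [uniformOn_univ, Measure.count_singleton, Fintype.card_prod, Fintype.card_fin,
      Fintype.card_fin, one_div]
    push_cast
    rfl
  · rw [← zero_add (M x.1 x.2), ← gaussianReal_map_const_add, zero_add,
      lintegral_map (by fun_prop) (by fun_prop)]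

instance [NeZero n] [NeZero d] (M : Matrix (Fin n) (Fin d) ℝ) :
    IsProbabilityMeasure (singleObs M (stdNoise n d)) := by
  have : IsProbabilityMeasure (uniformOn (Set.univ : Set (Fin n × Fin d))) :=
    isProbabilityMeasure_uniformOn Set.finite_univ Set.univ_nonempty
  refine isProbabilityMeasure_bind (measurable_of_finite _).aemeasurable
    (Filter.Eventually.of_forall fun x => ?_)
  exact Measure.isProbabilityMeasure_map (by fun_prop)

/-- The logarithm of the likelihood ratio of one observation when the mean is raised by `δ`. -/
noncomputable def logRatio (M : Matrix (Fin n) (Fin d) ℝ) (δ : ℝ) (e : (Fin n × Fin d) × ℝ) : ℝ :=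
  δ * (e.2 - M e.1.1 e.1.2) - δ ^ 2 / 2

theorem measurable_uncurry_fst {f : Fin n × Fin d → ℝ} :
    Measurable fun e : (Fin n × Fin d) × ℝ => f e.1 :=
  (measurable_of_finite f).comp measurable_fst

theorem measurable_logRatio (M : Matrix (Fin n) (Fin d) ℝ) (δ : ℝ) :
    Measurable (logRatio M δ) :=
  ((measurable_snd.sub (measurable_uncurry_fst (f := fun x => M x.1 x.2))).const_mul δ).sub_const _

theorem measurable_exp_logRatio (M : Matrix (Fin n) (Fin d) ℝ) (δ : ℝ) (w : Fin n × Fin d → ℝ) :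
    Measurable fun e => Real.exp (w e.1 * logRatio M δ e) :=
  (measurable_uncurry_fst.mul (measurable_logRatio M δ)).exp

theorem singleObs_withDensity {M₀ M : Matrix (Fin n) (Fin d) ℝ} {δ : ℝ}
    {w : Fin n × Fin d → ℝ} (hw : ∀ x, w x = 0 ∨ w x = 1)
    (hM : ∀ x, M x.1 x.2 = M₀ x.1 x.2 + δ * w x) :
    singleObs M (stdNoise n d) = (singleObs M₀ (stdNoise n d)).withDensity
      fun e => ENNReal.ofReal (Real.exp (w e.1 * logRatio M₀ δ e)) := by
  have hr := (measurable_exp_logRatio M₀ δ w).ennreal_ofReal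
  refine Measure.ext_of_lintegral _ fun h hh => ?_
  rw [lintegral_withDensity_eq_lintegral_mul _ hr hh, singleObs_stdNoise, singleObs_stdNoise,
    lintegral_finsetSum_measure, lintegral_finsetSum_measure]
  refine Finset.sum_congr rfl fun x _ => ?_
  rw [lintegral_smul_measure, lintegral_smul_measure, lintegral_map hh (by fun_prop),
    lintegral_map (hr.mul hh) (by fun_prop), hM, gaussianReal_eq_withDensity,
    lintegral_withDensity_eq_lintegral_mul _ (by fun_prop) (by fun_prop)]
  congr 1
  refine lintegral_congr fun y => ?_
  simp only [Pi.mul_apply, logRatio]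
  congr 3
  -- Shifting by `δ * w` puts `δ ^ 2 * w ^ 2` in the exponent instead of `δ ^ 2 * w`; they agree
  -- because `w` is `0` or `1`.
  rcases hw x with h | h <;> rw [h] <;> ring

theorem integrable_exp_logRatio [NeZero n] [NeZero d] (M : Matrix (Fin n) (Fin d) ℝ) (δ : ℝ)
    (w : Fin n × Fin d → ℝ) :
    Integrable (fun e => Real.exp (w e.1 * logRatio M δ e)) (singleObs M (stdNoise n d)) := by
  have hr := measurable_exp_logRatio M δ w
  rw [singleObs_stdNoise, integrable_finsetSum_measure]
  intro x _
  refine Integrable.smul_measure ?_ ?_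
  · rw [integrable_map_measure hr.aestronglyMeasurable (by fun_prop)]
    exact integrable_exp_tilt_gaussianReal (M x.1 x.2) δ (w x)
  · simp [NeZero.ne]

theorem integral_exp_logRatio [NeZero n] [NeZero d] (M : Matrix (Fin n) (Fin d) ℝ) (δ : ℝ)
    (w : Fin n × Fin d → ℝ) :
    ∫ e, Real.exp (w e.1 * logRatio M δ e) ∂(singleObs M (stdNoise n d))
      = (n * d : ℝ)⁻¹ * ∑ x, Real.exp (δ ^ 2 * (w x ^ 2 - w x) / 2) := by
  have hr := measurable_exp_logRatio M δ w
  have hi := integrable_exp_logRatio M δ w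
  rw [singleObs_stdNoise, integrable_finsetSum_measure] at hi
  rw [singleObs_stdNoise, integral_finsetSum_measure hi, Finset.mul_sum]
  refine Finset.sum_congr rfl fun x _ => ?_
  rw [integral_smul_measure, integral_map (by fun_prop) hr.aestronglyMeasurable, smul_eq_mul,
    ← integral_exp_tilt_gaussianReal (M x.1 x.2) δ (w x)]
  congr 1
  simp

/-- The likelihood ratio of the data when the mean is raised by `δ w`, for `w` valued in `{0, 1}`;
fractional powers and products of such ratios are of the same form. -/
noncomputable def likelihood (M : Matrix (Fin n) (Fin d) ℝ) (δ : ℝ) (w : Fin n × Fin d → ℝ)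
    (D : Data n d) : ℝ :=
  Real.exp (∑ t, w (D.2 t).1 * logRatio M δ (D.2 t))

theorem likelihood_eq_prod (M : Matrix (Fin n) (Fin d) ℝ) (δ : ℝ) (w : Fin n × Fin d → ℝ)
    (D : Data n d) :
    likelihood M δ w D = ∏ t, Real.exp (w (D.2 t).1 * logRatio M δ (D.2 t)) :=
  Real.exp_sum _ _

theorem likelihood_pos (M : Matrix (Fin n) (Fin d) ℝ) (δ : ℝ) (w : Fin n × Fin d → ℝ)
    (D : Data n d) : 0 < likelihood M δ w D :=
  Real.exp_pos _

theorem measurable_likelihood (M : Matrix (Fin n) (Fin d) ℝ) (δ : ℝ) (w : Fin n × Fin d → ℝ) :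
    Measurable (likelihood M δ w) :=
  (measurable_sampleSum (measurable_uncurry_fst.mul (measurable_logRatio M δ))).exp

theorem likelihood_mul (M : Matrix (Fin n) (Fin d) ℝ) (δ : ℝ) (w w' : Fin n × Fin d → ℝ)
    (D : Data n d) :
    likelihood M δ w D * likelihood M δ w' D = likelihood M δ (w + w') D := by
  simp only [likelihood, ← Real.exp_add, ← Finset.sum_add_distrib, Pi.add_apply, add_mul]

theorem likelihood_prod {ι : Type*} (s : Finset ι) (M : Matrix (Fin n) (Fin d) ℝ) (δ : ℝ)
    (w : ι → Fin n × Fin d → ℝ) (D : Data n d) :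
    ∏ i ∈ s, likelihood M δ (w i) D = likelihood M δ (fun x => ∑ i ∈ s, w i x) D := by
  simp only [likelihood, ← Real.exp_sum, Finset.sum_mul]
  rw [Finset.sum_comm]

theorem sqrt_likelihood (M : Matrix (Fin n) (Fin d) ℝ) (δ : ℝ) (w : Fin n × Fin d → ℝ)
    (D : Data n d) :
    √(likelihood M δ w D) = likelihood M δ (fun x => w x / 2) D := by
  rw [likelihood, ← Real.exp_half, likelihood, Finset.sum_div]
  congr 1
  exact Finset.sum_congr rfl fun t _ => by ring

/-- The law of the data with Gaussian noise. -/
noncomputable abbrev gaussLaw (lam : ℝ) (M : Matrix (Fin n) (Fin d) ℝ) : Measure (Data n d) :=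
  dataLaw lam M (stdNoise n d)

theorem gaussLaw_eq_poissonSample (lam : ℝ) (M : Matrix (Fin n) (Fin d) ℝ) :
    gaussLaw lam M = poissonSample (lam * n * d).toNNReal (singleObs M (stdNoise n d)) := rfl

instance [NeZero n] [NeZero d] (lam : ℝ) (M : Matrix (Fin n) (Fin d) ℝ) :
    IsProbabilityMeasure (gaussLaw lam M) := by
  rw [gaussLaw_eq_poissonSample]
  infer_instance

theorem gaussLaw_withDensity [NeZero n] [NeZero d] (lam : ℝ) {M₀ M : Matrix (Fin n) (Fin d) ℝ}
    {δ : ℝ} {w : Fin n × Fin d → ℝ} (hw : ∀ x, w x = 0 ∨ w x = 1)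
    (hM : ∀ x, M x.1 x.2 = M₀ x.1 x.2 + δ * w x) :
    gaussLaw lam M
      = (gaussLaw lam M₀).withDensity fun D => ENNReal.ofReal (likelihood M₀ δ w D) := by
  have h := singleObs_withDensity hw hM
  have : IsProbabilityMeasure ((singleObs M₀ (stdNoise n d)).withDensity
      fun e => ENNReal.ofReal (Real.exp (w e.1 * logRatio M₀ δ e))) := h ▸ inferInstance
  rw [gaussLaw_eq_poissonSample, gaussLaw_eq_poissonSample, h,
    poissonSample_withDensity _ _ (measurable_exp_logRatio M₀ δ w).ennreal_ofReal]
  congr 1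
  funext D
  rw [likelihood_eq_prod, ENNReal.ofReal_prod_of_nonneg fun _ _ => (Real.exp_pos _).le]

theorem integrable_likelihood [NeZero n] [NeZero d] (lam : ℝ) (M : Matrix (Fin n) (Fin d) ℝ)
    (δ : ℝ) (w : Fin n × Fin d → ℝ) : Integrable (likelihood M δ w) (gaussLaw lam M) := by
  rw [gaussLaw_eq_poissonSample]
  refine (integrable_sampleProd _ _ (measurable_exp_logRatio M δ w)
    (integrable_exp_logRatio M δ w)).congr (Filter.Eventually.of_forall fun D => ?_)
  exact (likelihood_eq_prod M δ w D).symm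

/-- Campbell's formula; the Poisson mean `lam * n * d` cancels the uniform weights, so a cell
contributes at rate `lam`. The values of `w` that matter are `1` (a density, contribution `0`), `2`
(second moments, `exp (δ ^ 2) - 1`) and `1 / 2` (affinities, `exp (-δ ^ 2 / 8) - 1`). -/
theorem integral_likelihood [NeZero n] [NeZero d] {lam : ℝ} (hlam : 0 ≤ lam)
    (M : Matrix (Fin n) (Fin d) ℝ) (δ : ℝ) (w : Fin n × Fin d → ℝ) :
    ∫ D, likelihood M δ w D ∂(gaussLaw lam M)
      = Real.exp (lam * ∑ x, (Real.exp (δ ^ 2 * (w x ^ 2 - w x) / 2) - 1)) := by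
  rw [gaussLaw_eq_poissonSample]
  simp only [likelihood_eq_prod]
  rw [integral_sampleProd _ _ (measurable_exp_logRatio M δ w) (integrable_exp_logRatio M δ w),
    integral_exp_logRatio, Real.coe_toNNReal _ (by positivity)]
  congr 1
  have hn : (n : ℝ) ≠ 0 := NeZero.ne _
  have hd : (d : ℝ) ≠ 0 := NeZero.ne _
  simp only [Finset.sum_sub_distrib, Finset.sum_const, Finset.card_univ, Fintype.card_prod,
    Fintype.card_fin, nsmul_eq_mul]
  push_cast
  field_simp

end

/-! ### From Hellinger affinities to testing errors. -/

section

/-- Weierstrass' product inequality; it turns small affinity losses of the factors into a bound for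
the product. -/
theorem one_sub_sum_le_prod_of_le {C : Type*} (s : Finset C) {a h : C → ℝ}
    (hh : ∀ c ∈ s, 0 ≤ h c) (ha : ∀ c ∈ s, 1 - h c ≤ a c) (hs : ∑ c ∈ s, h c ≤ 1) :
    1 - ∑ c ∈ s, h c ≤ ∏ c ∈ s, a c := by
  classical
  induction s using Finset.induction_on with
  | empty => simp
  | insert c s hc ih =>
    rw [Finset.sum_insert hc] at hs ⊢
    rw [Finset.prod_insert hc]
    have h0 := hh c (Finset.mem_insert_self c s)
    have hpos : 0 ≤ ∑ c ∈ s, h c :=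
      Finset.sum_nonneg fun i hi => hh i (Finset.mem_insert_of_mem hi)
    have ih' := ih (fun i hi => hh i (Finset.mem_insert_of_mem hi))
      (fun i hi => ha i (Finset.mem_insert_of_mem hi)) (by linarith)
    have hac := ha c (Finset.mem_insert_self c s)
    calc 1 - (h c + ∑ i ∈ s, h i) ≤ (1 - h c) * (1 - ∑ i ∈ s, h i) := by
          nlinarith [mul_nonneg h0 hpos]
      _ ≤ a c * ∏ i ∈ s, a i := mul_le_mul hac ih' (by linarith) (by linarith)

/-- A lower bound on the sum of the two errors of a test between two product densities, in terms
of the Hellinger affinities of the factors. -/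
theorem test_error_lower_bound {Ω C V : Type*} [MeasurableSpace Ω] {P : Measure Ω}
    [IsProbabilityMeasure P] [Fintype C] [MeasurableSpace V] {T : C → Ω → V}
    (hind : iIndepFun T P) (hT : ∀ c, Measurable (T c)) {A B : C → V → ℝ}
    (hA : ∀ c, Measurable (A c)) (hB : ∀ c, Measurable (B c))
    (hA0 : ∀ c v, 0 ≤ A c v) (hB0 : ∀ c v, 0 ≤ B c v)
    (hA1 : ∀ c, ∫ ω, A c (T c ω) ∂P = 1) (hB1 : ∀ c, ∫ ω, B c (T c ω) ∂P = 1)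
    {h : C → ℝ} (hh : ∀ c, 0 ≤ h c) (hs : ∑ c, h c ≤ 1 / 2)
    (haff : ∀ c, 1 - h c ≤ ∫ ω, √(A c (T c ω) * B c (T c ω)) ∂P)
    {φ : Ω → ℝ} (hφ : Measurable φ) (hφ0 : ∀ ω, 0 ≤ φ ω) (hφ1 : ∀ ω, φ ω ≤ 1) :
    1 / 8 ≤ ∫ ω, φ ω * ∏ c, A c (T c ω) ∂P + ∫ ω, (1 - φ ω) * ∏ c, B c (T c ω) ∂P := by
  have hAi : ∫ ω, ∏ c, A c (T c ω) ∂P = 1 := by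
    rw [hind.integral_fun_prod_comp (fun c => (hT c).aemeasurable)
      (fun c => (hA c).aestronglyMeasurable)]
    simp [hA1]
  have hBi : ∫ ω, ∏ c, B c (T c ω) ∂P = 1 := by
    rw [hind.integral_fun_prod_comp (fun c => (hT c).aemeasurable)
      (fun c => (hB c).aestronglyMeasurable)]
    simp [hB1]
  have hABi : 1 / 2 ≤ ∫ ω, ∏ c, √(A c (T c ω) * B c (T c ω)) ∂P := by
    rw [hind.integral_fun_prod_comp (f := fun c v => √(A c v * B c v))
      (fun c => (hT c).aemeasurable)
      (fun c => ((hA c).mul (hB c)).sqrt.aestronglyMeasurable)]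
    have := one_sub_sum_le_prod_of_le Finset.univ (fun c _ => hh c) (fun c _ => haff c)
      (by linarith)
    linarith
  set p : Ω → ℝ := fun ω => ∏ c, A c (T c ω) with hp
  set q : Ω → ℝ := fun ω => ∏ c, B c (T c ω) with hq
  have hip : Integrable p P := .of_integral_ne_zero (by rw [hAi]; norm_num)
  have hiq : Integrable q P := .of_integral_ne_zero (by rw [hBi]; norm_num)
  have his : Integrable (fun ω => ∏ c, √(A c (T c ω) * B c (T c ω))) P :=
    .of_integral_ne_zero (by linarith)
  have hbd : ∀ (f g : Ω → ℝ), Measurable f → (∀ ω, 0 ≤ f ω) → (∀ ω, f ω ≤ 1) → Integrable g P →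
      Integrable (fun ω => f ω * g ω) P := fun f g hf h0 h1 hg =>
    hg.bdd_mul hf.aestronglyMeasurable (c := 1)
      (Filter.Eventually.of_forall fun ω => by rw [Real.norm_of_nonneg (h0 ω)]; exact h1 ω)
  have hi1 := hbd φ p hφ hφ0 hφ1 hip
  have hi2 := hbd (fun ω => 1 - φ ω) q (hφ.const_sub 1) (fun ω => by linarith [hφ1 ω])
    (fun ω => by linarith [hφ0 ω]) hiq
  have hi12 : Integrable (fun ω => φ ω * p ω + (1 - φ ω) * q ω) P := hi1.add hi2
  have hipq : Integrable (fun ω => p ω + q ω) P := hip.add hiq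
  have hle : ∀ ω, ∏ c, √(A c (T c ω) * B c (T c ω))
      ≤ 2 * (φ ω * p ω + (1 - φ ω) * q ω) + (p ω + q ω) / 8 := by
    intro ω
    have hp0 : 0 ≤ p ω := Finset.prod_nonneg fun c _ => hA0 c _
    have hq0 : 0 ≤ q ω := Finset.prod_nonneg fun c _ => hB0 c _
    have h0 := hφ0 ω
    have h1 : 0 ≤ 1 - φ ω := by linarith [hφ1 ω]
    have e : ∏ c, √(A c (T c ω) * B c (T c ω)) = √(p ω * q ω) := by
      rw [hp, hq, ← Finset.prod_mul_distrib, Real.sqrt_prod _ fun c _ =>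
        mul_nonneg (hA0 c _) (hB0 c _)]
    rw [e]
    -- `u` is the integrand of the error and `v` its complement in `p + q`. Since `u * v - p * q = φ
    -- * (1 - φ) * (p - q) ^ 2 ≥ 0`, it suffices to bound `√(u * v)`.
    set u := φ ω * p ω + (1 - φ ω) * q ω with hu
    set v := (1 - φ ω) * p ω + φ ω * q ω with hv
    have huv : u + v = p ω + q ω := by rw [hu, hv]; ring
    have hu0 : 0 ≤ u := by positivity
    have hv0 : 0 ≤ v := by positivity
    have hpq : p ω * q ω ≤ u * v := by
      have : u * v - p ω * q ω = φ ω * (1 - φ ω) * (p ω - q ω) ^ 2 := by rw [hu, hv]; ring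
      have : 0 ≤ φ ω * (1 - φ ω) * (p ω - q ω) ^ 2 := by positivity
      linarith
    -- AM-GM with weights `2` and `1 / 8`: as `∫ (p + q) / 8 = 1 / 4`, an affinity of at least `1 /
    -- 2` leaves `1 / 4` for twice the error.
    have : √(p ω * q ω) ≤ 2 * u + v / 8 := by
      refine Real.sqrt_le_iff.2 ⟨by positivity, hpq.trans ?_⟩
      nlinarith [sq_nonneg (2 * u - v / 8)]
    linarith
  have hint := integral_mono his ((hi12.const_mul 2).add (hipq.div_const 8)) hle
  have e2 : ∫ ω, (2 * (φ ω * p ω + (1 - φ ω) * q ω) + (p ω + q ω) / 8) ∂P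
      = 2 * (∫ ω, φ ω * p ω ∂P + ∫ ω, (1 - φ ω) * q ω ∂P) + 1 / 4 := by
    rw [integral_add (hi12.const_mul 2) (hipq.div_const 8),
      integral_const_mul, integral_div, integral_add hi1 hi2, integral_add hip hiq, hAi, hBi]
    norm_num
  have hint' : ∫ ω, ∏ c, √(A c (T c ω) * B c (T c ω)) ∂P
      ≤ ∫ ω, (2 * (φ ω * p ω + (1 - φ ω) * q ω) + (p ω + q ω) / 8) ∂P := hint
  rw [e2] at hint'
  linarith

end

/-! ### Affinities of the blocks of cells. -/

section

variable {n d : ℕ} [NeZero n] [NeZero d]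

/-- The real indicator function of a Boolean predicate. -/
def ind {X : Type*} (a : X → Bool) (x : X) : ℝ := if a x then 1 else 0

theorem integral_likelihood_ind {lam : ℝ} (hlam : 0 ≤ lam) (M : Matrix (Fin n) (Fin d) ℝ) (δ : ℝ)
    (a : Fin n × Fin d → Bool) : ∫ D, likelihood M δ (ind a) D ∂(gaussLaw lam M) = 1 := by
  rw [integral_likelihood hlam, Finset.sum_eq_zero, mul_zero, Real.exp_zero]
  intro x _
  unfold ind
  split_ifs <;> simp

theorem integral_likelihood_mul {lam : ℝ} (hlam : 0 ≤ lam) (M : Matrix (Fin n) (Fin d) ℝ) (δ : ℝ)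
    (a b : Fin n × Fin d → Bool) :
    ∫ D, likelihood M δ (ind a) D * likelihood M δ (ind b) D ∂(gaussLaw lam M)
      = Real.exp (lam * (Real.exp (δ ^ 2) - 1)) ^
        (Finset.univ.filter fun x => a x = true ∧ b x = true).card := by
  simp only [likelihood_mul]
  rw [integral_likelihood hlam, ← Real.exp_nat_mul]
  congr 1
  have : ∀ x, Real.exp (δ ^ 2 * ((ind a + ind b) x ^ 2 - (ind a + ind b) x) / 2) - 1
      = if a x = true ∧ b x = true then Real.exp (δ ^ 2) - 1 else 0 := by
    intro x
    simp only [Pi.add_apply, ind]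
    by_cases ha : a x = true <;> by_cases hb : b x = true <;> simp [ha, hb]
    norm_num
  simp only [this]
  rw [← Finset.sum_filter, Finset.sum_const, nsmul_eq_mul]
  ring

/-- Only the cells raised in exactly one of the two arrangements matter. There are at most two, and
each costs at most `lam * δ ^ 2 / 8`. -/
theorem integral_sqrt_likelihood_mul_ge {lam : ℝ} (hlam : 0 ≤ lam)
    (M : Matrix (Fin n) (Fin d) ℝ) (δ : ℝ) (a b : Fin n × Fin d → Bool)
    (hab : (Finset.univ.filter fun x => a x = true ∧ b x = false).card ≤ 1)
    (hba : (Finset.univ.filter fun x => b x = true ∧ a x = false).card ≤ 1) :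
    1 - lam * δ ^ 2 / 4
      ≤ ∫ D, √(likelihood M δ (ind a) D * likelihood M δ (ind b) D) ∂(gaussLaw lam M) := by
  simp only [likelihood_mul, sqrt_likelihood]
  rw [integral_likelihood hlam]
  refine le_trans ?_ (Real.add_one_le_exp _)
  have h1 : ∀ x, -(δ ^ 2 / 8) * ((if a x = true ∧ b x = false then 1 else 0)
      + (if b x = true ∧ a x = false then 1 else 0))
      ≤ Real.exp (δ ^ 2 * (((ind a + ind b) x / 2) ^ 2 - (ind a + ind b) x / 2) / 2) - 1 := by
    intro x
    refine le_trans (le_of_eq ?_) (sub_le_sub_right (Real.add_one_le_exp _) 1)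
    simp only [Pi.add_apply, ind]
    cases a x <;> cases b x <;> simp <;> ring
  have h2 := Finset.sum_le_sum fun x (_ : x ∈ Finset.univ) => h1 x
  rw [← Finset.mul_sum, Finset.sum_add_distrib, Finset.sum_boole, Finset.sum_boole] at h2
  have h3 : (((Finset.univ.filter fun x => a x = true ∧ b x = false).card : ℕ) : ℝ) ≤ 1 := by
    exact_mod_cast hab
  have h4 : (((Finset.univ.filter fun x => b x = true ∧ a x = false).card : ℕ) : ℝ) ≤ 1 := by
    exact_mod_cast hba
  have h5 : -(δ ^ 2 / 4) ≤ ∑ x, (Real.exp (δ ^ 2 * (((ind a + ind b) x / 2) ^ 2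
      - (ind a + ind b) x / 2) / 2) - 1) := by
    nlinarith [sq_nonneg δ]
  nlinarith

theorem card_filter_le_card_and_add_one {X : Type*} [Fintype X] (a b : X → Bool)
    (hab : (Finset.univ.filter fun x => a x = true ∧ b x = false).card ≤ 1) :
    (Finset.univ.filter fun x => a x = true ∧ a x = true).card
      ≤ (Finset.univ.filter fun x => a x = true ∧ b x = true).card + 1 := by
  classical
  refine le_trans ((Finset.card_le_card ?_).trans (Finset.card_union_le _ _))
    (Nat.add_le_add_left hab _)
  intro x hx
  simp only [Finset.mem_filter, Finset.mem_univ, true_and, and_self, Finset.mem_union] at hx ⊢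
  cases b x <;> simp [hx]

/-- Expanding the square gives `κ ^ |a| + κ ^ |b| - 2 * κ ^ |a ∩ b|`, and both `|a|` and `|b|`
exceed `|a ∩ b|` by at most one. The factor `κ - 1` is the small one; `κ ^ m` stays bounded when `m
* lam * δ ^ 2` does. -/
theorem integral_likelihood_sub_sq_le {lam : ℝ} (hlam : 0 ≤ lam)
    (M : Matrix (Fin n) (Fin d) ℝ) (δ : ℝ) {m : ℕ} (a b : Fin n × Fin d → Bool)
    (ha : (Finset.univ.filter fun x => a x = true).card ≤ m)
    (hab : (Finset.univ.filter fun x => a x = true ∧ b x = false).card ≤ 1)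
    (hba : (Finset.univ.filter fun x => b x = true ∧ a x = false).card ≤ 1) :
    ∫ D, (likelihood M δ (ind a) D - likelihood M δ (ind b) D) ^ 2 ∂(gaussLaw lam M)
      ≤ 2 * (Real.exp (lam * (Real.exp (δ ^ 2) - 1)) ^ m *
        (Real.exp (lam * (Real.exp (δ ^ 2) - 1)) - 1)) := by
  set κ := Real.exp (lam * (Real.exp (δ ^ 2) - 1)) with hκ
  have hκ1 : 1 ≤ κ := by
    rw [hκ]
    refine Real.one_le_exp (mul_nonneg hlam ?_)
    linarith [Real.one_le_exp (sq_nonneg δ)]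
  have hint : ∀ u v : Fin n × Fin d → Bool, Integrable (fun D =>
      likelihood M δ (ind u) D * likelihood M δ (ind v) D) (gaussLaw lam M) := by
    intro u v
    simp only [likelihood_mul]
    exact integrable_likelihood _ _ _ _
  have e : ∀ D, (likelihood M δ (ind a) D - likelihood M δ (ind b) D) ^ 2
      = likelihood M δ (ind a) D * likelihood M δ (ind a) D
        + likelihood M δ (ind b) D * likelihood M δ (ind b) D
        - 2 * (likelihood M δ (ind a) D * likelihood M δ (ind b) D) := fun D => by ring
  simp only [e]
  have hi2 : Integrable (fun D => likelihood M δ (ind a) D * likelihood M δ (ind a) D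
        + likelihood M δ (ind b) D * likelihood M δ (ind b) D) (gaussLaw lam M) :=
    (hint a a).add (hint b b)
  rw [integral_sub hi2 ((hint a b).const_mul 2),
    integral_add (hint a a) (hint b b), integral_const_mul, integral_likelihood_mul hlam,
    integral_likelihood_mul hlam, integral_likelihood_mul hlam, ← hκ]
  have hNa := card_filter_le_card_and_add_one a b hab
  have hNb := card_filter_le_card_and_add_one b a hba
  have hcomm : (Finset.univ.filter fun x => b x = true ∧ a x = true)
      = Finset.univ.filter fun x => a x = true ∧ b x = true := by
    simp only [and_comm]
  rw [hcomm] at hNb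
  have hN0 : (Finset.univ.filter fun x => a x = true ∧ b x = true).card ≤ m := by
    refine (Finset.card_le_card ?_).trans ha
    intro x hx
    simp only [Finset.mem_filter, Finset.mem_univ, true_and] at hx ⊢
    exact hx.1
  set N := (Finset.univ.filter fun x => a x = true ∧ b x = true).card
  have h1 := pow_le_pow_right₀ hκ1 hNa
  have h2 := pow_le_pow_right₀ hκ1 hNb
  have h3 := pow_le_pow_right₀ hκ1 hN0
  rw [pow_succ] at h1 h2
  nlinarith [mul_le_mul_of_nonneg_right h3 (sub_nonneg.2 hκ1)]

/-- The arithmetic mean exceeds the geometric one by `(√x - √y) ^ 2 / 2`, where `(√x - √y) ^ 2 = (x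
- y) ^ 2 / (√x + √y) ^ 2`, and `(√x + √y) ^ 2 ≥ 2`. -/
theorem sqrt_mul_ge {x y : ℝ} (hx : 1 / 2 ≤ x) (hy : 1 / 2 ≤ y) :
    (x + y) / 2 - (x - y) ^ 2 / 4 ≤ √(x * y) := by
  have hx' := Real.sq_sqrt (show 0 ≤ x by linarith)
  have hy' := Real.sq_sqrt (show 0 ≤ y by linarith)
  rw [Real.sqrt_mul (by linarith)]
  set s := √x
  set t := √y
  have hs : 0 ≤ s := Real.sqrt_nonneg _
  have ht : 0 ≤ t := Real.sqrt_nonneg _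
  have hst : 1 / 2 ≤ s * t := by
    refine (pow_le_pow_iff_left₀ (by norm_num) (by positivity) two_ne_zero).1 ?_
    rw [mul_pow, hx', hy']
    nlinarith
  have h2 : 2 ≤ (s + t) ^ 2 := by nlinarith
  have h3 : (x - y) ^ 2 = (s - t) ^ 2 * (s + t) ^ 2 := by rw [← hx', ← hy']; ring
  rw [h3, ← hx', ← hy']
  nlinarith [mul_le_mul_of_nonneg_left h2 (sq_nonneg (s - t))]

/-- Mixing with mass `1 - q ≥ 1 / 2` on the constant `1` keeps both densities above `1 / 2`, so the
affinity loss is quadratic in their difference `q * (L - L')`. The resulting factor `q ^ 2` is the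
gain over known active blocks. -/
theorem integral_sqrt_mix_mul_ge {lam : ℝ} (hlam : 0 ≤ lam)
    (M : Matrix (Fin n) (Fin d) ℝ) (δ : ℝ) {q : ℝ} (hq0 : 0 ≤ q) (hq : q ≤ 1 / 2) {m : ℕ}
    (a b : Fin n × Fin d → Bool)
    (ha : (Finset.univ.filter fun x => a x = true).card ≤ m)
    (hab : (Finset.univ.filter fun x => a x = true ∧ b x = false).card ≤ 1)
    (hba : (Finset.univ.filter fun x => b x = true ∧ a x = false).card ≤ 1) :
    1 - q ^ 2 * (Real.exp (lam * (Real.exp (δ ^ 2) - 1)) ^ m *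
        (Real.exp (lam * (Real.exp (δ ^ 2) - 1)) - 1)) / 2
      ≤ ∫ D, √((1 - q + q * likelihood M δ (ind a) D) * (1 - q + q * likelihood M δ (ind b) D))
        ∂(gaussLaw lam M) := by
  have hm := integral_likelihood_sub_sq_le hlam M δ a b ha hab hba
  set F := likelihood M δ (ind a) with hF
  set F' := likelihood M δ (ind b) with hF'
  have hFi : Integrable F (gaussLaw lam M) := integrable_likelihood _ _ _ _
  have hFi' : Integrable F' (gaussLaw lam M) := integrable_likelihood _ _ _ _
  have hF0 : ∀ D, 0 ≤ F D := fun D => (likelihood_pos _ _ _ D).le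
  have hF0' : ∀ D, 0 ≤ F' D := fun D => (likelihood_pos _ _ _ D).le
  have hFm : Measurable F := measurable_likelihood _ _ _
  have hFm' : Measurable F' := measurable_likelihood _ _ _
  have hsq : Integrable (fun D => (F D - F' D) ^ 2) (gaussLaw lam M) := by
    have hint : ∀ u v : Fin n × Fin d → Bool, Integrable (fun D =>
        likelihood M δ (ind u) D * likelihood M δ (ind v) D) (gaussLaw lam M) := by
      intro u v
      simp only [likelihood_mul]
      exact integrable_likelihood _ _ _ _
    refine (((hint a a).add (hint b b)).sub ((hint a b).const_mul 2)).congr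
      (Filter.Eventually.of_forall fun D => ?_)
    simp only [Pi.add_apply, Pi.sub_apply, ← hF, ← hF']
    ring
  have hA : Integrable (fun D => 1 - q + q * F D) (gaussLaw lam M) :=
    (integrable_const _).add (hFi.const_mul q)
  have hB : Integrable (fun D => 1 - q + q * F' D) (gaussLaw lam M) :=
    (integrable_const _).add (hFi'.const_mul q)
  have hAB : Integrable (fun D => ((1 - q + q * F D) + (1 - q + q * F' D)) / 2)
      (gaussLaw lam M) := (hA.add hB).div_const 2
  have hsq' : Integrable (fun D => q ^ 2 * (F D - F' D) ^ 2 / 4) (gaussLaw lam M) :=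
    (hsq.const_mul _).div_const 4
  have hroot : Integrable (fun D => √((1 - q + q * F D) * (1 - q + q * F' D)))
      (gaussLaw lam M) := by
    refine hAB.mono' (by fun_prop) (Filter.Eventually.of_forall fun D => ?_)
    have h1 : 0 ≤ 1 - q + q * F D := by nlinarith [hF0 D]
    have h2 : 0 ≤ 1 - q + q * F' D := by nlinarith [hF0' D]
    rw [Real.norm_of_nonneg (Real.sqrt_nonneg _)]
    refine Real.sqrt_le_iff.2 ⟨by positivity, ?_⟩
    nlinarith [sq_nonneg ((1 - q + q * F D) - (1 - q + q * F' D))]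
  have hle : ∀ D, ((1 - q + q * F D) + (1 - q + q * F' D)) / 2 - q ^ 2 * (F D - F' D) ^ 2 / 4
      ≤ √((1 - q + q * F D) * (1 - q + q * F' D)) := by
    intro D
    have := sqrt_mul_ge (x := 1 - q + q * F D) (y := 1 - q + q * F' D)
      (by nlinarith [mul_nonneg hq0 (hF0 D)]) (by nlinarith [mul_nonneg hq0 (hF0' D)])
    refine le_trans (le_of_eq ?_) this
    ring
  refine le_trans ?_ (integral_mono (hAB.sub hsq') hroot hle)
  have e1 : ∫ D, (1 - q + q * F D) ∂(gaussLaw lam M) = 1 := by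
    rw [integral_add (integrable_const _) (hFi.const_mul q), integral_const_mul, hF,
      integral_likelihood_ind hlam]
    simp
  have e2 : ∫ D, (1 - q + q * F' D) ∂(gaussLaw lam M) = 1 := by
    rw [integral_add (integrable_const _) (hFi'.const_mul q), integral_const_mul, hF',
      integral_likelihood_ind hlam]
    simp
  have e3 : ∫ D, (((1 - q + q * F D) + (1 - q + q * F' D)) / 2 - q ^ 2 * (F D - F' D) ^ 2 / 4)
      ∂(gaussLaw lam M) = 1 - q ^ 2 * (∫ D, (F D - F' D) ^ 2 ∂(gaussLaw lam M)) / 4 := by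
    rw [integral_sub hAB hsq', integral_div, integral_add hA hB, e1, e2, integral_div,
      integral_const_mul]
    norm_num
  refine le_trans ?_ (le_of_eq e3.symm)
  nlinarith [mul_le_mul_of_nonneg_left hm (sq_nonneg q)]

/-- The posterior mixture, in a block, of the likelihood ratio `y` and of `1`; in a revealed block
it is `y` itself. -/
def mix (q : ℝ) (revealed : Prop) [Decidable revealed] (y : ℝ) : ℝ :=
  if revealed then y else 1 - q + q * y

/-- Lower bound on the two errors of a test between two arrangements of raised cells: each block
(a class of `blk`) is raised with probability `q`, independently, except that the block `c₀` is
always raised. -/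
theorem block_test_error_lower_bound {C : Type*} [Fintype C] [DecidableEq C]
    {lam : ℝ} (hlam : 0 ≤ lam) (M : Matrix (Fin n) (Fin d) ℝ) (δ : ℝ) {q η : ℝ} {m : ℕ}
    (hη : 0 ≤ η)
    (hq : (q = 1 ∧ lam * δ ^ 2 / 4 ≤ η) ∨ (0 ≤ q ∧ q ≤ 1 / 2 ∧
      q ^ 2 * (Real.exp (lam * (Real.exp (δ ^ 2) - 1)) ^ m *
        (Real.exp (lam * (Real.exp (δ ^ 2) - 1)) - 1)) / 2 ≤ η))
    (blk : Fin n × Fin d → C) (c₀ : C) (Cs : Finset C)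
    (hsum : lam * δ ^ 2 / 4 + Cs.card * η ≤ 1 / 2)
    (a b : Fin n × Fin d → Bool)
    (heq : ∀ x, blk x ∉ Cs → a x = b x)
    (ha : ∀ c ∈ Cs, (Finset.univ.filter fun x => (a x && decide (blk x = c)) = true).card ≤ m)
    (hab : ∀ c ∈ Cs, (Finset.univ.filter fun x => (a x && decide (blk x = c)) = true ∧
      (b x && decide (blk x = c)) = false).card ≤ 1)
    (hba : ∀ c ∈ Cs, (Finset.univ.filter fun x => (b x && decide (blk x = c)) = true ∧
      (a x && decide (blk x = c)) = false).card ≤ 1)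
    {φ : Data n d → ℝ} (hφ : Measurable φ) (hφ0 : ∀ ω, 0 ≤ φ ω) (hφ1 : ∀ ω, φ ω ≤ 1) :
    1 / 8 ≤
      ∫ D, φ D * ∏ c, mix q (c = c₀)
        (likelihood M δ (ind fun x => a x && decide (blk x = c)) D) ∂(gaussLaw lam M)
      + ∫ D, (1 - φ D) * ∏ c, mix q (c = c₀)
        (likelihood M δ (ind fun x => b x && decide (blk x = c)) D) ∂(gaussLaw lam M) := by
  let _ : MeasurableSpace C := ⊤
  have hblk : Measurable fun e : (Fin n × Fin d) × ℝ => blk e.1 :=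
    (measurable_of_finite blk).comp measurable_fst
  -- The log-likelihoods of the two arrangements are packed as real and imaginary parts, so that a
  -- single family of independent statistics, one per block, determines both densities.
  set ψ : (Fin n × Fin d) × ℝ → ℂ := fun e =>
    ((ind a e.1 * logRatio M δ e : ℝ) : ℂ) + ((ind b e.1 * logRatio M δ e : ℝ) : ℂ) * Complex.I
    with hψdef
  have hψ : Measurable ψ := by
    have h1 : Measurable fun e : (Fin n × Fin d) × ℝ => ind a e.1 * logRatio M δ e :=
      measurable_uncurry_fst.mul (measurable_logRatio M δ)
    have h2 : Measurable fun e : (Fin n × Fin d) × ℝ => ind b e.1 * logRatio M δ e :=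
      measurable_uncurry_fst.mul (measurable_logRatio M δ)
    exact (Complex.measurable_ofReal.comp h1).add
      ((Complex.measurable_ofReal.comp h2).mul_const _)
  have hind := iIndepFun_sampleSum (lam * n * d).toNNReal (singleObs M (stdNoise n d)) hblk hψ
  rw [← gaussLaw_eq_poissonSample] at hind
  set T : C → Data n d → ℂ := fun c D => ∑ t, if blk (D.2 t).1 = c then ψ (D.2 t) else 0 with hTdef
  have hT : ∀ c, Measurable (T c) := fun c =>
    measurable_sampleSum (Measurable.ite (hblk (measurableSet_singleton c)) hψ measurable_const)
  have hre : ∀ c D, Real.exp (T c D).re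
      = likelihood M δ (ind fun x => a x && decide (blk x = c)) D := by
    intro c D
    rw [likelihood, hTdef]
    simp only [Complex.re_sum]
    congr 1
    refine Finset.sum_congr rfl fun t _ => ?_
    by_cases h : blk (D.2 t).1 = c <;> simp [h, hψdef, ind]
  have him : ∀ c D, Real.exp (T c D).im
      = likelihood M δ (ind fun x => b x && decide (blk x = c)) D := by
    intro c D
    rw [likelihood, hTdef]
    simp only [Complex.im_sum]
    congr 1
    refine Finset.sum_congr rfl fun t _ => ?_
    by_cases h : blk (D.2 t).1 = c <;> simp [h, hψdef, ind]
  have hq01 : 0 ≤ q ∧ q ≤ 1 := by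
    rcases hq with ⟨h, _⟩ | ⟨h0, h1, _⟩
    · constructor <;> linarith
    · exact ⟨h0, by linarith⟩
  have hmixm : ∀ (c : C), Measurable fun y : ℝ => mix q (c = c₀) y := by
    intro c
    unfold mix
    split_ifs <;> fun_prop
  have hmix0 : ∀ (c : C) (y : ℝ), 0 ≤ y → 0 ≤ mix q (c = c₀) y := by
    intro c y hy
    unfold mix
    split_ifs
    · exact hy
    · nlinarith [mul_nonneg hq01.1 hy]
  have hmix1 : ∀ (c : C) (u : Fin n × Fin d → Bool),
      ∫ D, mix q (c = c₀) (likelihood M δ (ind u) D) ∂(gaussLaw lam M) = 1 := by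
    intro c u
    unfold mix
    split_ifs
    · exact integral_likelihood_ind hlam M δ u
    · rw [integral_add (integrable_const _) ((integrable_likelihood _ _ _ _).const_mul q),
        integral_const_mul, integral_likelihood_ind hlam]
      simp
  have main := test_error_lower_bound hind hT
    (A := fun c v => mix q (c = c₀) (Real.exp v.re)) (B := fun c v => mix q (c = c₀) (Real.exp v.im))
    (fun c => (hmixm c).comp (Real.measurable_exp.comp Complex.measurable_re))
    (fun c => (hmixm c).comp (Real.measurable_exp.comp Complex.measurable_im))
    (fun c v => hmix0 c _ (Real.exp_pos _).le) (fun c v => hmix0 c _ (Real.exp_pos _).le)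
    (fun c => by simp only [hre]; exact hmix1 c _)
    (fun c => by simp only [him]; exact hmix1 c _)
    (h := fun c => (if c = c₀ then lam * δ ^ 2 / 4 else 0) + if c ∈ Cs then η else 0)
    (fun c => by positivity)
    (by
      rw [Finset.sum_add_distrib, Finset.sum_ite_eq' Finset.univ, if_pos (Finset.mem_univ _),
        Finset.sum_ite_mem, Finset.univ_inter, Finset.sum_const, nsmul_eq_mul]
      exact hsum)
    (by
      intro c
      simp only [hre, him]
      have hlδ : 0 ≤ lam * δ ^ 2 / 4 := by positivity
      by_cases hc : c ∈ Cs
      · rw [if_pos hc]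
        have hroot := integral_sqrt_likelihood_mul_ge hlam M δ _ _ (hab c hc) (hba c hc)
        by_cases hc0 : c = c₀
        · simp only [mix, if_pos hc0]
          linarith
        · simp only [mix, if_neg hc0]
          rcases hq with ⟨h, h'⟩ | ⟨h0, h1, h'⟩
          · simp only [h, sub_self, zero_add, one_mul]
            linarith
          · have := integral_sqrt_mix_mul_ge hlam M δ h0 h1 _ _ (ha c hc) (hab c hc) (hba c hc)
            linarith
      -- Outside `Cs` the two arrangements agree, the two densities coincide, and the affinity is
      -- their mass `1`.
      · have hEq : (fun x => b x && decide (blk x = c)) = fun x => a x && decide (blk x = c) := by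
          funext x
          by_cases hx : blk x = c
          · rw [heq x (hx ▸ hc)]
          · simp [hx]
        rw [hEq]
        have : ∀ D, √(mix q (c = c₀) (likelihood M δ (ind fun x => a x && decide (blk x = c)) D) *
            mix q (c = c₀) (likelihood M δ (ind fun x => a x && decide (blk x = c)) D))
            = mix q (c = c₀) (likelihood M δ (ind fun x => a x && decide (blk x = c)) D) :=
          fun D => Real.sqrt_mul_self (hmix0 c _ (likelihood_pos _ _ _ _).le)
        simp only [this, hmix1, if_neg hc, add_zero]
        split_ifs <;> linarith)
    hφ hφ0 hφ1
  simpa only [hre, him] using main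

end

/-! ### Row designs, their signals and the loss they force. -/

section

/-- A partition of the rows into consecutive groups with low and high rows, in which some low rows
are paired with a high row of their group. -/
structure RowDesign (n m : ℕ) where
  group : Fin n → Fin n
  high : Fin n → Bool
  partner : Fin n → Fin n
  partner_partner : ∀ i, partner (partner i) = i
  group_partner : ∀ i, group (partner i) = group i
  high_partner : ∀ i, partner i ≠ i → high (partner i) = !high i
  group_mono : Monotone group
  high_mono : ∀ i j, i ≤ j → group i = group j → high i = true → high j = true
  card_high_le : ∀ g, (Finset.univ.filter fun i => group i = g ∧ high i = true).card ≤ m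

namespace RowDesign

variable {n d m : ℕ} (R : RowDesign n m)

/-- The low member of the pair of a row. -/
def low (i : Fin n) : Fin n := if R.high i then R.partner i else i

theorem low_partner (i : Fin n) : R.low (R.partner i) = R.low i := by
  by_cases h : R.partner i = i
  · rw [h]
  · unfold low
    rw [R.high_partner i h, R.partner_partner]
    cases R.high i <;> simp

theorem group_low (i : Fin n) : R.group (R.low i) = R.group i := by
  unfold low
  split_ifs
  · exact R.group_partner i
  · rfl

/-- The permutation exchanging the members of the pairs selected by `σ`. -/
def swap (σ : Fin n → Bool) : Equiv.Perm (Fin n) :=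
  Function.Involutive.toPerm (fun i => if σ (R.low i) then R.partner i else i) (by
    intro i
    by_cases h : σ (R.low i) = true
    · simp [h, R.low_partner, R.partner_partner]
    · simp [h])

theorem swap_apply (σ : Fin n → Bool) (i : Fin n) :
    R.swap σ i = if σ (R.low i) then R.partner i else i := rfl

theorem group_swap (σ : Fin n → Bool) (i : Fin n) : R.group (R.swap σ i) = R.group i := by
  rw [swap_apply]
  split_ifs
  · exact R.group_partner i
  · rfl

/-- Whether a row occupies a high position once the pairs selected by `σ` are exchanged. -/
def lifted (σ : Fin n → Bool) (i : Fin n) : Bool := R.high (R.swap σ i)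

/-- The low rows that have a partner. -/
def pairs : Finset (Fin n) := Finset.univ.filter fun i => R.high i = false ∧ R.partner i ≠ i

theorem lifted_of_mem_pairs {i : Fin n} (hi : i ∈ R.pairs) (σ : Fin n → Bool) :
    R.lifted σ i = σ i := by
  simp only [pairs, Finset.mem_filter, Finset.mem_univ, true_and] at hi
  have hl : R.low i = i := by simp [low, hi.1]
  have hp := R.high_partner i hi.2
  rw [lifted, swap_apply, hl]
  cases h : σ i <;> simp [hi.1, hp]

theorem lifted_partner {i : Fin n} (hi : i ∈ R.pairs) (σ : Fin n → Bool) :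
    R.lifted σ (R.partner i) = !σ i := by
  simp only [pairs, Finset.mem_filter, Finset.mem_univ, true_and] at hi
  have hl : R.low i = i := by simp [low, hi.1]
  have hp := R.high_partner i hi.2
  rw [lifted, swap_apply, low_partner, hl, R.partner_partner]
  cases h : σ i <;> simp [hi.1, hp]

theorem lifted_update {i u : Fin n} (hu : R.low u ≠ i) (σ : Fin n → Bool) (v : Bool) :
    R.lifted (Function.update σ i v) u = R.lifted σ u := by
  simp only [lifted, swap_apply, Function.update_of_ne hu]

theorem eq_or_eq_partner_of_low_eq {i u : Fin n} (hu : R.low u = i) :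
    u = i ∨ u = R.partner i := by
  unfold low at hu
  split_ifs at hu
  · exact Or.inr (by rw [← hu, R.partner_partner])
  · exact Or.inl hu

/-- The block of a cell: the group of its row, and its column. -/
def block (x : Fin n × Fin d) : Fin n × Fin d := (R.group x.1, x.2)

/-- `swap σ` preserves groups and carries the raised rows of a block injectively to high positions
of its group. -/
theorem card_lifted_block_le (σ : Fin n → Bool) (c : Fin n × Fin d) :
    (Finset.univ.filter fun x : Fin n × Fin d =>
      (R.lifted σ x.1 && decide (R.block x = c)) = true).card ≤ m := by
  refine le_trans ?_ (R.card_high_le c.1)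
  refine Finset.card_le_card_of_injOn (fun x => R.swap σ x.1) ?_ ?_
  · intro x hx
    simp only [Finset.coe_filter, Finset.mem_univ, true_and, Set.mem_ofPred_eq, Bool.and_eq_true,
      decide_eq_true_eq] at hx ⊢
    refine ⟨?_, hx.1⟩
    rw [group_swap, ← hx.2]
    rfl
  · intro x hx y hy hxy
    simp only [Finset.coe_filter, Finset.mem_univ, true_and, Set.mem_ofPred_eq, Bool.and_eq_true,
      decide_eq_true_eq] at hx hy
    refine Prod.ext ((R.swap σ).injective hxy) ?_
    exact (congrArg Prod.snd hx.2).trans (congrArg Prod.snd hy.2).symm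

/-- Only `i` and its partner can change status, and exactly one of the two is raised under `σ`; the
column of the block fixes the cell. -/
theorem card_lifted_sub_le_one {i : Fin n} (hi : i ∈ R.pairs) (σ σ' : Fin n → Bool)
    (hσ : ∀ u, R.low u ≠ i → R.lifted σ' u = R.lifted σ u) (c : Fin n × Fin d) :
    (Finset.univ.filter fun x : Fin n × Fin d =>
      (R.lifted σ x.1 && decide (R.block x = c)) = true ∧
      (R.lifted σ' x.1 && decide (R.block x = c)) = false).card ≤ 1 := by
  rw [Finset.card_le_one]
  have key : ∀ x ∈ (Finset.univ.filter fun x : Fin n × Fin d =>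
      (R.lifted σ x.1 && decide (R.block x = c)) = true ∧
      (R.lifted σ' x.1 && decide (R.block x = c)) = false),
      x = (if σ i then i else R.partner i, c.2) := by
    intro x hx
    simp only [Finset.mem_filter, Finset.mem_univ, true_and, Bool.and_eq_true,
      decide_eq_true_eq] at hx
    obtain ⟨⟨h1, h2⟩, h3⟩ := hx
    simp only [h2, decide_true, Bool.and_true] at h3
    have hl : R.low x.1 = i := by
      by_contra h
      rw [hσ _ h, h1] at h3
      exact absurd h3 (by simp)
    refine Prod.ext ?_ (by rw [← h2]; rfl)
    rcases R.eq_or_eq_partner_of_low_eq hl with h | h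
    · rw [h, lifted_of_mem_pairs R hi] at h1
      simp [h1, h]
    · rw [h, lifted_partner R hi] at h1
      simp only [Bool.not_eq_true'] at h1
      simp [h1, h]
  intro x hx y hy
  rw [key x hx, key y hy]

/-- The isotonic matrix of levels: the high positions of group `g` are raised by `δ` in the columns
`k` with `S (g, k)`. -/
noncomputable def level (S : Fin n × Fin d → Bool) (δ : ℝ) : Matrix (Fin n) (Fin d) ℝ :=
  fun p k => 2 * δ * (R.group p : ℕ) + if (R.high p && S (R.group p, k)) = true then δ else 0

/-- The levels without the raised cells. -/
noncomputable def baseLevel (d : ℕ) (δ : ℝ) : Matrix (Fin n) (Fin d) ℝ :=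
  fun p _ => 2 * δ * (R.group p : ℕ)

/-- The signal whose rows are the levels permuted by `swap σ`. -/
noncomputable def signal (σ : Fin n → Bool) (S : Fin n × Fin d → Bool) (δ : ℝ) :
    Matrix (Fin n) (Fin d) ℝ :=
  fun r k => R.level S δ (R.swap σ r) k

theorem signal_eq (σ : Fin n → Bool) (S : Fin n × Fin d → Bool) (δ : ℝ) (x : Fin n × Fin d) :
    R.signal σ S δ x.1 x.2
      = R.baseLevel d δ x.1 x.2 + δ * ind (fun x => R.lifted σ x.1 && S (R.block x)) x := by
  have h : R.signal σ S δ x.1 x.2 = 2 * δ * (R.group (R.swap σ x.1) : ℕ)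
      + if (R.lifted σ x.1 && S (R.group (R.swap σ x.1), x.2)) = true then δ else 0 := rfl
  have h2 : δ * ind (fun x => R.lifted σ x.1 && S (R.block x)) x
      = if (R.lifted σ x.1 && S (R.group x.1, x.2)) = true then δ else 0 :=
    (mul_ite _ _ _ _).trans (by rw [mul_one, mul_zero]; rfl)
  rw [h, h2, group_swap]
  rfl

/-- The base jumps by `2 * δ` between groups, more than any raise, so monotonicity survives every
choice of active blocks. -/
theorem level_isotonic (S : Fin n × Fin d → Bool) {δ : ℝ} (hδ : 0 ≤ δ)
    (hδ1 : ∀ i, 2 * δ * (R.group i : ℕ) + δ ≤ 1) : R.level S δ ∈ isotonic n d := by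
  refine ⟨fun i k => ⟨?_, ?_⟩, fun k i j hij => ?_⟩
  · unfold level
    positivity
  · refine le_trans ?_ (hδ1 i)
    unfold level
    split_ifs <;> linarith
  · simp only [level]
    rcases (R.group_mono hij).lt_or_eq with h | h
    · have h1 : ((R.group i : ℕ) : ℝ) + 1 ≤ (R.group j : ℕ) := by exact_mod_cast h
      have h2 : 2 * δ * ((R.group i : ℕ) + 1) ≤ 2 * δ * (R.group j : ℕ) :=
        mul_le_mul_of_nonneg_left h1 (by linarith)
      split_ifs <;> linarith
    · rw [h]
      have := R.high_mono i j hij h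
      by_cases hi : R.high i = true
      · rw [hi, this hi]
      · simp only [hi, Bool.false_and, Bool.false_eq_true, if_false]
        split_ifs <;> linarith

/-- Within a group, positions of different types differ by exactly `δ` in an active column. Between
groups the base gap `2 * δ` minus a raise of at most `δ` still leaves `δ`, so putting a row in a
wrong group does not help the estimator. -/
theorem sq_level_sub_ge (S : Fin n × Fin d → Bool) {δ : ℝ} (hδ : 0 ≤ δ) {i j : Fin n} {k : Fin d}
    (hij : R.high i ≠ R.high j) (hS : S (R.group i, k) = true) :
    δ ^ 2 ≤ (R.level S δ j k - R.level S δ i k) ^ 2 := by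
  rw [sq_le_sq, abs_of_nonneg hδ, le_abs]
  simp only [level]
  rcases lt_trichotomy (R.group i) (R.group j) with h | h | h
  · have h1 : ((R.group i : ℕ) : ℝ) + 1 ≤ (R.group j : ℕ) := by exact_mod_cast h
    have h2 : 2 * δ * ((R.group i : ℕ) + 1) ≤ 2 * δ * (R.group j : ℕ) :=
      mul_le_mul_of_nonneg_left h1 (by linarith)
    left
    split_ifs <;> linarith
  · rw [← h, hS]
    cases hi : R.high i <;> cases hj : R.high j <;> simp_all
  · have h1 : ((R.group j : ℕ) : ℝ) + 1 ≤ (R.group i : ℕ) := by exact_mod_cast h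
    have h2 : 2 * δ * ((R.group j : ℕ) + 1) ≤ 2 * δ * (R.group i : ℕ) :=
      mul_le_mul_of_nonneg_left h1 (by linarith)
    right
    split_ifs <;> linarith

/-- The parameters of the model given by a design. -/
noncomputable def param {𝒩 : Set (NoiseFamily n d)} (h𝒩 : stdNoise n d ∈ 𝒩) {δ : ℝ} (hδ : 0 ≤ δ)
    (hδ1 : ∀ i, 2 * δ * (R.group i : ℕ) + δ ≤ 1) (σ : Fin n → Bool) (S : Fin n × Fin d → Bool) :
    Param n d 𝒩 where
  perm := R.swap σ
  signal := R.signal σ S δ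
  noise := stdNoise n d
  isotonic_permRows := by
    have : permRows (R.signal σ S δ) (R.swap σ) = R.level S δ := by
      funext i k
      simp [permRows, signal]
    rw [this]
    exact R.level_isotonic S hδ hδ1
  noise_mem := h𝒩

/-- A lower bound for the loss: the paired rows put at a position of the wrong type. -/
noncomputable def errorLoss (S : Fin n × Fin d → Bool) (δ : ℝ) (σ : Fin n → Bool)
    (π : Equiv.Perm (Fin n)) : ℝ :=
  ∑ r ∈ R.pairs, ∑ k : Fin d, (if S (R.group r, k) = true then δ ^ 2 else 0) *
    ({π : Equiv.Perm (Fin n) | R.high (π r) ≠ σ r}.indicator 1 π)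

theorem errorLoss_le {𝒩 : Set (NoiseFamily n d)} (h𝒩 : stdNoise n d ∈ 𝒩) {δ : ℝ} (hδ : 0 ≤ δ)
    (hδ1 : ∀ i, 2 * δ * (R.group i : ℕ) + δ ≤ 1) (σ : Fin n → Bool) (S : Fin n × Fin d → Bool)
    (π : Equiv.Perm (Fin n)) :
    ENNReal.ofReal (R.errorLoss S δ σ π) ≤ permLoss (R.param h𝒩 hδ hδ1 σ S) π := by
  unfold permLoss errorLoss
  refine ENNReal.ofReal_le_ofReal ?_
  have e : ∑ i, ∑ k, (permRows (R.param h𝒩 hδ hδ1 σ S).signal π i k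
      - permRows (R.param h𝒩 hδ hδ1 σ S).signal (R.param h𝒩 hδ hδ1 σ S).perm i k) ^ 2
      = ∑ r, ∑ k, (R.level S δ (R.swap σ r) k - R.level S δ (π r) k) ^ 2 := by
    -- Reindexing positions by rows: row `r` belongs at level `swap σ r`, and the estimate compares
    -- it with level `π r`.
    rw [← Equiv.sum_comp π]
    simp [permRows, param, signal]
  rw [e]
  refine (Finset.sum_le_sum fun r hr => Finset.sum_le_sum fun k _ => ?_).trans
    (Finset.sum_le_univ_sum_of_nonneg fun r => Finset.sum_nonneg fun k _ => sq_nonneg _)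
  by_cases hS : S (R.group r, k) = true
  · by_cases hπ : R.high (π r) ≠ σ r
    · have := R.sq_level_sub_ge S hδ (i := R.swap σ r) (j := π r) (k := k)
        (by rw [← lifted, R.lifted_of_mem_pairs hr]; exact hπ.symm) (by rw [group_swap]; exact hS)
      rw [if_pos hS, Set.indicator_of_mem (by exact hπ), Pi.one_apply, mul_one]
      rw [sub_sq_comm]
      exact this
    · rw [Set.indicator_of_notMem (by exact hπ), mul_zero]
      positivity
  · rw [if_neg hS, zero_mul]
    positivity

/-- The weight of `S` under the prior with independent entries that are `true` with
probability `q`. -/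
def weight {C : Type*} [Fintype C] (q : ℝ) (S : C → Bool) : ℝ := ∏ c, if S c = true then q else 1 - q

theorem sum_weight {C : Type*} [Fintype C] [DecidableEq C] (q : ℝ) :
    ∑ S : C → Bool, weight q S = 1 := by
  unfold weight
  rw [← Fintype.prod_sum (fun (_ : C) (b : Bool) => if b = true then q else 1 - q)]
  simp

theorem likelihood_block (σ : Fin n → Bool) (S : Fin n × Fin d → Bool)
    (M : Matrix (Fin n) (Fin d) ℝ) (δ : ℝ) (D : Data n d) :
    likelihood M δ (ind fun x => R.lifted σ x.1 && S (R.block x)) D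
      = ∏ c, if S c = true then
        likelihood M δ (ind fun x => R.lifted σ x.1 && decide (R.block x = c)) D else 1 := by
  rw [← Finset.prod_filter, likelihood_prod]
  congr 1
  funext x
  have : ∀ c, ind (fun x => R.lifted σ x.1 && decide (R.block x = c)) x
      = if R.block x = c then ind (fun x => R.lifted σ x.1) x else 0 := by
    intro c
    by_cases h : R.block x = c <;> simp [ind, h]
  simp only [this]
  rw [Finset.sum_filter]
  simp only [← ite_and]
  rw [Finset.sum_eq_single (R.block x)]
  · cases h : S (R.block x) <;> simp [ind, h]
  · intro c _ hc
    simp [Ne.symm hc]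
  · simp

/-- Both the prior and the likelihood factor over blocks, so the sum over `S` is a product of
two-term sums: `q * L` at `c₀`, where the activity is imposed, and `1 - q + q * L` elsewhere. -/
theorem sum_weight_mul_likelihood (q : ℝ) (σ : Fin n → Bool) (c₀ : Fin n × Fin d)
    (M : Matrix (Fin n) (Fin d) ℝ) (δ : ℝ) (D : Data n d) :
    ∑ S : Fin n × Fin d → Bool, weight q S * ((if S c₀ = true then 1 else 0) *
        likelihood M δ (ind fun x => R.lifted σ x.1 && S (R.block x)) D)
      = q * ∏ c, mix q (c = c₀)
        (likelihood M δ (ind fun x => R.lifted σ x.1 && decide (R.block x = c)) D) := by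
  set F : Fin n × Fin d → ℝ := fun c =>
    likelihood M δ (ind fun x => R.lifted σ x.1 && decide (R.block x = c)) D with hF
  have h1 : ∀ S : Fin n × Fin d → Bool, weight q S * ((if S c₀ = true then 1 else 0) *
        likelihood M δ (ind fun x => R.lifted σ x.1 && S (R.block x)) D)
      = ∏ c, if S c = true then q * F c else if c = c₀ then 0 else 1 - q := by
    intro S
    rw [likelihood_block, weight]
    by_cases hS : S c₀ = true
    · rw [if_pos hS, one_mul, ← Finset.prod_mul_distrib]
      refine Finset.prod_congr rfl fun c _ => ?_
      by_cases hc : S c = true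
      · simp only [hc, if_true, hF]
      · have : c ≠ c₀ := fun h => hc (h ▸ hS)
        simp [hc, this]
    · rw [if_neg hS, zero_mul, mul_zero]
      exact (Finset.prod_eq_zero (Finset.mem_univ c₀) (by simp [hS])).symm
  simp only [h1]
  rw [← Fintype.prod_sum (fun (c : Fin n × Fin d) (b : Bool) =>
    if b = true then q * F c else if c = c₀ then 0 else 1 - q)]
  have h2 : ∀ c, ∑ b : Bool, (if b = true then q * F c else if c = c₀ then 0 else 1 - q)
      = (if c = c₀ then q else 1) * mix q (c = c₀) (F c) := by
    intro c
    by_cases hc : c = c₀ <;> simp [hc, mix]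
    ring
  simp only [h2]
  rw [Finset.prod_mul_distrib, Finset.prod_ite_eq' Finset.univ, if_pos (Finset.mem_univ _)]

/-- The probability that the estimator `κ` puts row `r` at a position of type other than `v`. -/
noncomputable def err (κ : Kernel (Data n d) (Equiv.Perm (Fin n))) (r : Fin n) (v : Bool)
    (D : Data n d) : ℝ := (κ D).real {π | R.high (π r) ≠ v}

theorem measurable_err (κ : Kernel (Data n d) (Equiv.Perm (Fin n))) (r : Fin n) (v : Bool) : Measurable (R.err κ r v) :=
  (κ.measurable_coe (MeasurableSpace.measurableSet_top)).ennreal_toReal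

theorem err_nonneg (κ : Kernel (Data n d) (Equiv.Perm (Fin n))) (r : Fin n) (v : Bool) (D : Data n d) : 0 ≤ R.err κ r v D :=
  measureReal_nonneg

theorem err_le_one (κ : Kernel (Data n d) (Equiv.Perm (Fin n)))
    [IsMarkovKernel κ] (r : Fin n) (v : Bool) (D : Data n d) : R.err κ r v D ≤ 1 :=
  measureReal_le_one

theorem err_not (κ : Kernel (Data n d) (Equiv.Perm (Fin n)))
    [IsMarkovKernel κ] (r : Fin n) (v : Bool) (D : Data n d) :
    R.err κ r (!v) D = 1 - R.err κ r v D := by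
  have : {π : Equiv.Perm (Fin n) | R.high (π r) ≠ !v}
      = {π : Equiv.Perm (Fin n) | R.high (π r) ≠ v}ᶜ := by
    ext π
    cases h : R.high (π r) <;> cases v <;> simp [h]
  rw [err, this, probReal_compl_eq_one_sub MeasurableSpace.measurableSet_top]
  rfl

theorem integral_errorLoss (κ : Kernel (Data n d) (Equiv.Perm (Fin n)))
    [IsMarkovKernel κ] (S : Fin n × Fin d → Bool) (δ : ℝ) (σ : Fin n → Bool) (D : Data n d) :
    ∫ π, R.errorLoss S δ σ π ∂(κ D) = ∑ r ∈ R.pairs, ∑ k : Fin d,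
      (if S (R.group r, k) = true then δ ^ 2 else 0) * R.err κ r (σ r) D := by
  have hms : ∀ s : Set (Equiv.Perm (Fin n)), MeasurableSet s :=
    fun s => MeasurableSpace.measurableSet_top
  have hi : ∀ r, Integrable ({π : Equiv.Perm (Fin n) | R.high (π r) ≠ σ r}.indicator
      (1 : Equiv.Perm (Fin n) → ℝ)) (κ D) := fun r =>
    (integrable_const (1 : ℝ)).indicator (hms _)
  unfold errorLoss
  rw [integral_finsetSum _ fun r _ => integrable_finsetSum _ fun k _ => (hi r).const_mul _]
  refine Finset.sum_congr rfl fun r _ => ?_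
  rw [integral_finsetSum _ fun k _ => (hi r).const_mul _]
  refine Finset.sum_congr rfl fun k _ => ?_
  rw [integral_const_mul, integral_indicator_one (hms _)]
  rfl

end RowDesign

end

/-! ### Averaging over the prior. -/

section

theorem exists_ge_of_sum_mul_ge {ι : Type*} (s : Finset ι) {w f : ι → ℝ} {a : ℝ}
    (hw : ∀ i ∈ s, 0 ≤ w i) (hpos : 0 < ∑ i ∈ s, w i)
    (h : (∑ i ∈ s, w i) * a ≤ ∑ i ∈ s, w i * f i) : ∃ i ∈ s, a ≤ f i := by
  by_contra! hlt
  have hnn : ∀ i ∈ s, 0 ≤ w i * (a - f i) := fun i hi =>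
    mul_nonneg (hw i hi) (by linarith [hlt i hi])
  have hs : ∑ i ∈ s, w i * (a - f i) = 0 := by
    refine le_antisymm ?_ (Finset.sum_nonneg hnn)
    simp only [mul_sub, Finset.sum_sub_distrib, ← Finset.sum_mul]
    linarith
  have hz := (Finset.sum_eq_zero_iff_of_nonneg hnn).1 hs
  have : ∑ i ∈ s, w i = 0 := Finset.sum_eq_zero fun i hi => by
    rcases mul_eq_zero.1 (hz i hi) with h0 | h0
    · exact h0
    · linarith [hlt i hi]
  linarith

/-- Flipping bit `i` is an involution of the cube, so the average of `f` is half that of `f σ + f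
(flip σ)`. -/
theorem sum_ge_of_flip_ge {n : ℕ} (i : Fin n) {f : (Fin n → Bool) → ℝ} {a : ℝ}
    (h : ∀ σ, a ≤ f σ + f (Function.update σ i (!σ i))) :
    (2 : ℝ) ^ n * (a / 2) ≤ ∑ σ, f σ := by
  have hinv : Function.Involutive fun σ : Fin n → Bool => Function.update σ i (!σ i) := by
    intro σ
    simp
  have e := Equiv.sum_comp hinv.toPerm f
  have h2 := Finset.sum_le_sum fun σ (_ : σ ∈ Finset.univ) => h σ
  rw [Finset.sum_add_distrib, Finset.sum_const, nsmul_eq_mul, Finset.card_univ,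
    Fintype.card_fun, Fintype.card_bool, Fintype.card_fin] at h2
  have e' : ∑ σ, f (Function.update σ i (!σ i)) = ∑ σ, f σ := e
  rw [e'] at h2
  push_cast at h2
  linarith

namespace RowDesign

variable {n d m : ℕ} (R : RowDesign n m)

/-- The expected error loss, computed under the reference law. -/
noncomputable def bayesTerm (lam δ : ℝ) (κ : Kernel (Data n d) (Equiv.Perm (Fin n)))
    (σ : Fin n → Bool) (S : Fin n × Fin d → Bool) : ℝ :=
  ∑ r ∈ R.pairs, ∑ k : Fin d, δ ^ 2 * ∫ D, R.err κ r (σ r) D * ((if S (R.group r, k) = true then 1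
    else 0) * likelihood (R.baseLevel d δ) δ (ind fun x => R.lifted σ x.1 && S (R.block x)) D)
    ∂(gaussLaw lam (R.baseLevel d δ))

theorem integrable_err_mul [NeZero n] [NeZero d] (κ : Kernel (Data n d) (Equiv.Perm (Fin n)))
    [IsMarkovKernel κ] {P : Measure (Data n d)} (r : Fin n) (v : Bool) {g : Data n d → ℝ}
    (hg : Integrable g P) : Integrable (fun D => R.err κ r v D * g D) P :=
  hg.bdd_mul (R.measurable_err κ r v).aestronglyMeasurable (c := 1)
    (Filter.Eventually.of_forall fun D => by
      rw [Real.norm_of_nonneg (R.err_nonneg κ r v D)]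
      exact R.err_le_one κ r v D)

/-- Change of measure to the unraised signal, a reference law common to all `σ` and `S`, followed by
`errorLoss_le`. -/
theorem bayesTerm_le_risk [NeZero n] [NeZero d] (lam : ℝ) {𝒩 : Set (NoiseFamily n d)}
    (h𝒩 : stdNoise n d ∈ 𝒩) {δ : ℝ} (hδ : 0 ≤ δ) (hδ1 : ∀ i, 2 * δ * (R.group i : ℕ) + δ ≤ 1)
    (κ : Kernel (Data n d) (Equiv.Perm (Fin n))) [IsMarkovKernel κ]
    (σ : Fin n → Bool) (S : Fin n × Fin d → Bool) :
    ENNReal.ofReal (R.bayesTerm lam δ κ σ S) ≤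
      ∫⁻ π, permLoss (R.param h𝒩 hδ hδ1 σ S) π
        ∂((κ ∘ₖ model n d lam 𝒩) (R.param h𝒩 hδ hδ1 σ S)) := by
  set θ := R.param h𝒩 hδ hδ1 σ S with hθ
  set Z := likelihood (R.baseLevel d δ) δ (ind fun x => R.lifted σ x.1 && S (R.block x)) with hZ
  set P₀ := gaussLaw lam (R.baseLevel d δ) with hP₀
  have hZm : Measurable Z := measurable_likelihood _ _ _
  have hZ0 : ∀ D, 0 ≤ Z D := fun D => (likelihood_pos _ _ _ D).le
  have hZi : Integrable Z P₀ := integrable_likelihood _ _ _ _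
  have hms : ∀ s : Set (Equiv.Perm (Fin n)), MeasurableSet s :=
    fun s => MeasurableSpace.measurableSet_top
  have hperm : ∀ {β : Type} [MeasurableSpace β] (f : Equiv.Perm (Fin n) → β), Measurable f :=
    fun f => measurable_from_top
  have hlaw : model n d lam 𝒩 θ = P₀.withDensity fun D => ENNReal.ofReal (Z D) :=
    gaussLaw_withDensity lam (fun x => by unfold ind; split_ifs <;> simp)
      (R.signal_eq σ S δ)
  rw [Kernel.lintegral_comp _ _ _ (hperm _), hlaw,
    lintegral_withDensity_eq_lintegral_mul _ hZm.ennreal_ofReal (Measurable.lintegral_kernel (hperm _))]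
  have hel0 : ∀ π, 0 ≤ R.errorLoss S δ σ π := by
    intro π
    unfold errorLoss
    refine Finset.sum_nonneg fun r _ => Finset.sum_nonneg fun k _ => mul_nonneg ?_ ?_
    · split_ifs <;> positivity
    · exact Set.indicator_nonneg (fun _ _ => zero_le_one) _
  have hin : ∀ D, ENNReal.ofReal (∑ r ∈ R.pairs, ∑ k : Fin d,
      (if S (R.group r, k) = true then δ ^ 2 else 0) * R.err κ r (σ r) D)
      ≤ ∫⁻ π, permLoss θ π ∂(κ D) := by
    intro D
    rw [← R.integral_errorLoss κ S δ σ D, ofReal_integral_eq_lintegral_ofReal]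
    · exact lintegral_mono fun π => R.errorLoss_le h𝒩 hδ hδ1 σ S π
    · exact Integrable.of_finite
    · exact Filter.Eventually.of_forall hel0
  have hpt : ∀ D, ENNReal.ofReal (Z D * ∑ r ∈ R.pairs, ∑ k : Fin d,
      (if S (R.group r, k) = true then δ ^ 2 else 0) * R.err κ r (σ r) D)
      ≤ ENNReal.ofReal (Z D) * ∫⁻ π, permLoss θ π ∂(κ D) := by
    intro D
    rw [ENNReal.ofReal_mul (hZ0 D)]
    exact mul_le_mul_right (hin D) _
  refine le_trans ?_ (lintegral_mono hpt)
  have hterm : ∀ r k, Integrable (fun D => δ ^ 2 * (R.err κ r (σ r) D *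
      ((if S (R.group r, k) = true then 1 else 0) * Z D))) P₀ := fun r k =>
    (R.integrable_err_mul κ r (σ r) (hZi.const_mul _)).const_mul _
  have hrw : ∀ D, Z D * ∑ r ∈ R.pairs, ∑ k : Fin d,
      (if S (R.group r, k) = true then δ ^ 2 else 0) * R.err κ r (σ r) D
      = ∑ r ∈ R.pairs, ∑ k : Fin d, δ ^ 2 * (R.err κ r (σ r) D *
        ((if S (R.group r, k) = true then 1 else 0) * Z D)) := by
    intro D
    simp only [Finset.mul_sum]
    refine Finset.sum_congr rfl fun r _ => Finset.sum_congr rfl fun k _ => ?_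
    split_ifs <;> ring
  simp only [hrw]
  rw [← ofReal_integral_eq_lintegral_ofReal]
  · refine ENNReal.ofReal_le_ofReal (le_of_eq ?_)
    rw [integral_finsetSum _ fun r _ => integrable_finsetSum _ fun k _ => hterm r k]
    unfold bayesTerm
    refine Finset.sum_congr rfl fun r _ => ?_
    rw [integral_finsetSum _ fun k _ => hterm r k]
    refine Finset.sum_congr rfl fun k _ => ?_
    rw [integral_const_mul]
  · exact integrable_finsetSum _ fun r _ => integrable_finsetSum _ fun k _ => hterm r k
  · refine Filter.Eventually.of_forall fun D => ?_
    refine Finset.sum_nonneg fun r _ => Finset.sum_nonneg fun k _ => ?_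
    refine mul_nonneg (sq_nonneg _) (mul_nonneg (R.err_nonneg κ _ _ _) (mul_nonneg ?_ (hZ0 D)))
    split_ifs <;> norm_num

theorem sum_weight_mul_bayesTerm [NeZero n] [NeZero d] (lam δ q : ℝ)
    (κ : Kernel (Data n d) (Equiv.Perm (Fin n))) [IsMarkovKernel κ] (σ : Fin n → Bool) :
    ∑ S : Fin n × Fin d → Bool, weight q S * R.bayesTerm lam δ κ σ S
      = ∑ r ∈ R.pairs, ∑ k : Fin d, δ ^ 2 * q * ∫ D, R.err κ r (σ r) D *
        ∏ c, mix q (c = (R.group r, k)) (likelihood (R.baseLevel d δ) δ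
          (ind fun x => R.lifted σ x.1 && decide (R.block x = c)) D)
        ∂(gaussLaw lam (R.baseLevel d δ)) := by
  unfold bayesTerm
  simp only [Finset.mul_sum]
  rw [Finset.sum_comm]
  refine Finset.sum_congr rfl fun r _ => ?_
  rw [Finset.sum_comm]
  refine Finset.sum_congr rfl fun k _ => ?_
  have hi : ∀ S : Fin n × Fin d → Bool, Integrable (fun D => weight q S *
      (R.err κ r (σ r) D * ((if S (R.group r, k) = true then 1 else 0) *
        likelihood (R.baseLevel d δ) δ (ind fun x => R.lifted σ x.1 && S (R.block x)) D)))
      (gaussLaw lam (R.baseLevel d δ)) := fun S =>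
    (R.integrable_err_mul κ r (σ r) ((integrable_likelihood _ _ _ _).const_mul _)).const_mul _
  have e : ∀ S : Fin n × Fin d → Bool, weight q S * (δ ^ 2 * ∫ D, R.err κ r (σ r) D *
      ((if S (R.group r, k) = true then 1 else 0) *
        likelihood (R.baseLevel d δ) δ (ind fun x => R.lifted σ x.1 && S (R.block x)) D)
      ∂(gaussLaw lam (R.baseLevel d δ)))
      = δ ^ 2 * ∫ D, weight q S * (R.err κ r (σ r) D *
        ((if S (R.group r, k) = true then 1 else 0) *
        likelihood (R.baseLevel d δ) δ (ind fun x => R.lifted σ x.1 && S (R.block x)) D))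
      ∂(gaussLaw lam (R.baseLevel d δ)) := by
    intro S
    rw [integral_const_mul]
    ring
  simp only [e]
  rw [← Finset.mul_sum, ← integral_finsetSum _ fun S _ => hi S, mul_assoc, ← integral_const_mul q]
  congr 2
  funext D
  have h := R.sum_weight_mul_likelihood q σ (R.group r, k) (R.baseLevel d δ) δ D
  rw [mul_left_comm, ← h, Finset.mul_sum]
  refine Finset.sum_congr rfl fun S _ => ?_
  ring

theorem weight_nonneg {C : Type*} [Fintype C] {q : ℝ} (h0 : 0 ≤ q) (h1 : q ≤ 1) (S : C → Bool) :
    0 ≤ weight q S := by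
  refine Finset.prod_nonneg fun c _ => ?_
  split_ifs <;> linarith

/-- Lower bound for the minimax risk given by a design. -/
theorem riskPerm_ge [NeZero n] [NeZero d] {lam : ℝ} (hlam : 0 ≤ lam) {𝒩 : Set (NoiseFamily n d)}
    (h𝒩 : stdNoise n d ∈ 𝒩) {δ : ℝ} (hδ : 0 ≤ δ) (hδ1 : ∀ i, 2 * δ * (R.group i : ℕ) + δ ≤ 1)
    {q η : ℝ} (hη : 0 ≤ η)
    (hq : (q = 1 ∧ lam * δ ^ 2 / 4 ≤ η) ∨ (0 ≤ q ∧ q ≤ 1 / 2 ∧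
      q ^ 2 * (Real.exp (lam * (Real.exp (δ ^ 2) - 1)) ^ m *
        (Real.exp (lam * (Real.exp (δ ^ 2) - 1)) - 1)) / 2 ≤ η))
    (hsum : lam * δ ^ 2 / 4 + d * η ≤ 1 / 2) :
    ENNReal.ofReal (R.pairs.card * d * δ ^ 2 * q / 16) ≤ riskPerm n d lam 𝒩 := by
  unfold riskPerm minimaxRisk
  refine le_iInf₂ fun κ hκ => ?_
  have hq01 : 0 ≤ q ∧ q ≤ 1 := by
    rcases hq with ⟨h, _⟩ | ⟨h0, h1, _⟩
    · constructor <;> linarith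
    · exact ⟨h0, by linarith⟩
  set Q : Fin n → Fin d → (Fin n → Bool) → ℝ := fun r k σ => ∫ D, R.err κ r (σ r) D *
        ∏ c, mix q (c = (R.group r, k)) (likelihood (R.baseLevel d δ) δ
          (ind fun x => R.lifted σ x.1 && decide (R.block x = c)) D)
        ∂(gaussLaw lam (R.baseLevel d δ)) with hQ
  have hflip : ∀ r ∈ R.pairs, ∀ k σ, 1 / 8 ≤ Q r k σ + Q r k (Function.update σ r (!σ r)) := by
    intro r hr k σ
    set σ' := Function.update σ r (!σ r) with hσ'
    have hup : ∀ u, R.low u ≠ r → R.lifted σ' u = R.lifted σ u :=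
      fun u hu => R.lifted_update hu σ _
    -- The error of the estimator on row `r` acts as a randomized test between `σ` and its flip at
    -- `r`, and only the `d` blocks of the group of `r` are affected.
    have h := block_test_error_lower_bound hlam (R.baseLevel d δ) δ (m := m) hη hq R.block
      (R.group r, k) (({R.group r} : Finset (Fin n)) ×ˢ Finset.univ)
      (by simpa using hsum)
      (fun x => R.lifted σ x.1) (fun x => R.lifted σ' x.1)
      (by
        intro x hx
        refine (hup x.1 fun h => hx ?_).symm
        simp [block, ← h, R.group_low])
      (fun c _ => R.card_lifted_block_le σ c)
      (fun c _ => R.card_lifted_sub_le_one hr σ σ' hup c)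
      (fun c _ => R.card_lifted_sub_le_one hr σ' σ (fun u hu => (hup u hu).symm) c)
      (R.measurable_err κ r (σ r)) (R.err_nonneg κ r (σ r)) (R.err_le_one κ r (σ r))
    have he : ∀ D, R.err κ r (σ' r) D = 1 - R.err κ r (σ r) D := by
      intro D
      rw [hσ', Function.update_self, R.err_not]
    simp only [hQ, he]
    exact h
  have havg : ∑ σS : (Fin n → Bool) × (Fin n × Fin d → Bool),
      weight q σS.2 * R.bayesTerm lam δ κ σS.1 σS.2
      = ∑ r ∈ R.pairs, ∑ k : Fin d, δ ^ 2 * q * ∑ σ, Q r k σ := by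
    rw [Fintype.sum_prod_type]
    simp only [R.sum_weight_mul_bayesTerm, Finset.mul_sum]
    rw [Finset.sum_comm]
    refine Finset.sum_congr rfl fun r _ => ?_
    rw [Finset.sum_comm]
  have hw : ∑ σS : (Fin n → Bool) × (Fin n × Fin d → Bool), weight q σS.2 = (2 : ℝ) ^ n := by
    rw [Fintype.sum_prod_type]
    simp [sum_weight]
  -- The prior is uniform on `σ` without normalization, hence of mass `2 ^ n`. Some parameter does
  -- at least as badly as the average, and `1 / 16` is half of the testing error `1 / 8`.
  obtain ⟨⟨σ, S⟩, -, hσS⟩ := exists_ge_of_sum_mul_ge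
    (Finset.univ : Finset ((Fin n → Bool) × (Fin n × Fin d → Bool)))
    (w := fun σS => weight q σS.2) (f := fun σS => R.bayesTerm lam δ κ σS.1 σS.2)
    (a := R.pairs.card * d * δ ^ 2 * q / 16)
    (fun σS _ => weight_nonneg hq01.1 hq01.2 σS.2) (by rw [hw]; positivity) (by
      rw [havg, hw]
      have : ∀ r ∈ R.pairs, ∀ k ∈ (Finset.univ : Finset (Fin d)),
          δ ^ 2 * q * ((2 : ℝ) ^ n * (1 / 8 / 2)) ≤ δ ^ 2 * q * ∑ σ, Q r k σ := fun r hr k _ =>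
        mul_le_mul_of_nonneg_left (sum_ge_of_flip_ge r (hflip r hr k))
          (mul_nonneg (sq_nonneg _) hq01.1)
      refine le_trans (le_of_eq ?_)
        (Finset.sum_le_sum fun r hr => Finset.sum_le_sum fun k hk => this r hr k hk)
      simp only [Finset.sum_const, Finset.card_univ, Fintype.card_fin, nsmul_eq_mul]
      ring)
  refine (ENNReal.ofReal_le_ofReal hσS).trans ?_
  exact (R.bayesTerm_le_risk lam h𝒩 hδ hδ1 κ σ S).trans
    (le_iSup (fun θ => ∫⁻ π, permLoss θ π ∂((κ ∘ₖ model n d lam 𝒩) θ)) (R.param h𝒩 hδ hδ1 σ S))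

end RowDesign

end

/-! ### The concrete design and the choice of `m`, `δ` and `q`. -/

section

theorem div_two_mul_eq {m a b : ℕ} (hb : b < 2 * m) : (2 * m * a + b) / (2 * m) = a := by
  rw [Nat.mul_add_div (by omega), Nat.div_eq_of_lt hb, add_zero]

theorem mod_two_mul_eq {m a b : ℕ} (hb : b < 2 * m) : (2 * m * a + b) % (2 * m) = b := by
  rw [Nat.mul_add_mod, Nat.mod_eq_of_lt hb]

theorem add_div_mod_of_low {m i : ℕ} (h : i % (2 * m) < m) :
    (i + m) / (2 * m) = i / (2 * m) ∧ (i + m) % (2 * m) = i % (2 * m) + m := by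
  have e : i + m = 2 * m * (i / (2 * m)) + (i % (2 * m) + m) := by
    rw [← add_assoc, Nat.div_add_mod]
  rw [e]
  exact ⟨by rw [div_two_mul_eq (by omega)], mod_two_mul_eq (by omega)⟩

theorem sub_div_mod_of_high {m i : ℕ} (hm : 1 ≤ m) (h : m ≤ i % (2 * m)) :
    m ≤ i ∧ (i - m) / (2 * m) = i / (2 * m) ∧ (i - m) % (2 * m) = i % (2 * m) - m := by
  have hlt := Nat.mod_lt i (show 2 * m > 0 by omega)
  have e0 := Nat.div_add_mod i (2 * m)
  have e : i - m = 2 * m * (i / (2 * m)) + (i % (2 * m) - m) := by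
    generalize 2 * m * (i / (2 * m)) = z at *
    omega
  refine ⟨h.trans (Nat.mod_le _ _), ?_⟩
  rw [e]
  exact ⟨by rw [div_two_mul_eq (by omega)], mod_two_mul_eq (by omega)⟩

/-- Consecutive groups of `2 m` rows, made of `m` low rows followed by `m` high rows; the row `i` is
paired with `i + m`. -/
def stdDesign (n m : ℕ) (hm : 1 ≤ m) : RowDesign n m where
  group i := ⟨i / (2 * m), (Nat.div_le_self _ _).trans_lt i.2⟩
  high i := decide (m ≤ i % (2 * m))
  -- In a truncated last group, a low row without a row `m` places further is its own partner, that
  -- is, unpaired.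
  partner i := if i % (2 * m) < m then (if h : i + m < n then ⟨i + m, h⟩ else i)
    else ⟨i - m, (Nat.sub_le _ _).trans_lt i.2⟩
  partner_partner i := by
    by_cases h1 : (i : ℕ) % (2 * m) < m
    · by_cases h2 : (i : ℕ) + m < n
      · simp only [h1, h2, if_true, dif_pos, (add_div_mod_of_low h1).2]
        rw [if_neg (by omega)]
        ext
        simp
      · simp [h1, h2]
    · obtain ⟨h3, h4, h5⟩ := sub_div_mod_of_high hm (not_lt.1 h1)
      have hlt := Nat.mod_lt i (show 2 * m > 0 by omega)
      have h6 : (i : ℕ) - m + m = i := by omega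
      simp only [h1, if_false, h5, h6, i.2, dif_pos]
      rw [if_pos (by omega)]
  group_partner i := by
    ext
    by_cases h1 : (i : ℕ) % (2 * m) < m
    · by_cases h2 : (i : ℕ) + m < n
      · simp [h1, h2, (add_div_mod_of_low h1).1]
      · simp [h1, h2]
    · simp [h1, (sub_div_mod_of_high hm (not_lt.1 h1)).2.1]
  high_partner i hi := by
    by_cases h1 : (i : ℕ) % (2 * m) < m
    · by_cases h2 : (i : ℕ) + m < n
      · simp [h1, h2, (add_div_mod_of_low h1).2]
      · simp [h1, h2] at hi
    · have hlt := Nat.mod_lt i (show 2 * m > 0 by omega)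
      have h5 := (sub_div_mod_of_high hm (not_lt.1 h1)).2.2
      simp only [h1, if_false, h5]
      rw [decide_eq_false (by omega), decide_eq_true (not_lt.1 h1)]
      rfl
  group_mono i j hij := by
    simp only [Fin.mk_le_mk]
    exact Nat.div_le_div_right hij
  high_mono i j hij hg hi := by
    simp only [Fin.mk.injEq, decide_eq_true_eq] at hg hi ⊢
    have e1 := Nat.div_add_mod i (2 * m)
    have e2 := Nat.div_add_mod j (2 * m)
    rw [hg] at e1
    have : (i : ℕ) ≤ j := hij
    omega
  card_high_le g := by
    refine le_of_le_of_eq (b := (Finset.range m).card) (Finset.card_le_card_of_injOn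
      (fun i : Fin n => (i : ℕ) % (2 * m) - m) ?_ ?_) (Finset.card_range m)
    · intro i hi
      have hlt := Nat.mod_lt i (show 2 * m > 0 by omega)
      simp only [Finset.coe_range, Set.mem_Iio]
      omega
    · intro i hi j hj hij
      simp only [Finset.coe_filter, Finset.mem_univ, true_and, Set.mem_ofPred_eq,
        decide_eq_true_eq] at hi hj hij
      have hg : (i : ℕ) / (2 * m) = (j : ℕ) / (2 * m) :=
        congrArg Fin.val (hi.1.trans hj.1.symm)
      have e1 := Nat.div_add_mod i (2 * m)
      have e2 := Nat.div_add_mod j (2 * m)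
      rw [hg] at e1
      ext
      omega

/-- With `K = n / (2 * m) ≥ 1` complete groups there are at least `K * m` pairs, while `n < 2 * m *
(K + 1) ≤ 4 * K * m`. -/
theorem le_four_mul_card_pairs {n m : ℕ} (hm : 1 ≤ m) (hmn : 2 * m ≤ n) :
    n ≤ 4 * (stdDesign n m hm).pairs.card := by
  have hK : 1 ≤ n / (2 * m) := Nat.div_pos hmn (by omega)
  have hlt : ∀ a b : ℕ, a < n / (2 * m) → b < m → 2 * m * a + b + m < n := by
    intro a b ha hb
    have h1 : 2 * m * (a + 1) ≤ 2 * m * (n / (2 * m)) := Nat.mul_le_mul_left _ ha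
    have h2 : 2 * m * (n / (2 * m)) ≤ n := Nat.mul_div_le n (2 * m)
    rw [mul_add] at h1
    omega
  have hcard : n / (2 * m) * m ≤ (stdDesign n m hm).pairs.card := by
    have : (Finset.univ : Finset (Fin (n / (2 * m)) × Fin m)).card = n / (2 * m) * m := by simp
    rw [← this]
    refine Finset.card_le_card_of_injOn (fun x => (⟨2 * m * x.1 + x.2, by
      have := hlt x.1 x.2 x.1.2 x.2.2
      omega⟩ : Fin n)) ?_ ?_
    · intro x _
      have h0 := x.2.2
      have h1 := hlt x.1 x.2 x.1.2 h0
      have h2 : (2 * m * (x.1 : ℕ) + x.2) % (2 * m) = x.2 := mod_two_mul_eq (by omega)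
      simp only [RowDesign.pairs, stdDesign, Finset.coe_filter, Finset.mem_univ, true_and,
        Set.mem_ofPred_eq, h2, h1, h0, if_true, dif_pos, decide_eq_false_iff_not, not_le, ne_eq,
        Fin.mk.injEq]
      omega
    · intro x _ y _ hxy
      simp only [Fin.mk.injEq] at hxy
      have hx2 := x.2.2
      have hy2 := y.2.2
      have h1 := congrArg (· / (2 * m)) hxy
      have h2 := congrArg (· % (2 * m)) hxy
      rw [div_two_mul_eq (by omega), div_two_mul_eq (by omega)] at h1
      rw [mod_two_mul_eq (by omega), mod_two_mul_eq (by omega)] at h2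
      exact Prod.ext (Fin.ext h1) (Fin.ext h2)
  have h3 := Nat.div_add_mod n (2 * m)
  have h4 := Nat.mod_lt n (show 2 * m > 0 by omega)
  have h5 : m ≤ n / (2 * m) * m := Nat.le_mul_of_pos_left m hK
  have h6 : 2 * m * (n / (2 * m)) = 2 * (n / (2 * m) * m) := by ring
  omega

variable {n d : ℕ}

/-- `δ ≤ m / (2 * n)` keeps the levels in `[0,1]`: group indices are at most `n / (2 * m)`, so the
base stays below `1 / 2`. -/
theorem riskPerm_ge_of_groups [NeZero n] [NeZero d] {lam : ℝ} (hlam : 0 ≤ lam)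
    {𝒩 : Set (NoiseFamily n d)} (h𝒩 : stdNoise n d ∈ 𝒩) {m : ℕ} (hm : 1 ≤ m) (hmn : 2 * m ≤ n)
    {δ : ℝ} (hδ : 0 ≤ δ) (hδm : δ ≤ m / (2 * n)) {q η : ℝ} (hη : 0 ≤ η)
    (hq : (q = 1 ∧ lam * δ ^ 2 / 4 ≤ η) ∨ (0 ≤ q ∧ q ≤ 1 / 2 ∧
      q ^ 2 * (Real.exp (lam * (Real.exp (δ ^ 2) - 1)) ^ m *
        (Real.exp (lam * (Real.exp (δ ^ 2) - 1)) - 1)) / 2 ≤ η))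
    (hsum : lam * δ ^ 2 / 4 + d * η ≤ 1 / 2) :
    ENNReal.ofReal (n * d * δ ^ 2 * q / 64) ≤ riskPerm n d lam 𝒩 := by
  have hq0 : 0 ≤ q := by
    rcases hq with ⟨h, _⟩ | ⟨h0, _⟩
    · linarith
    · exact h0
  have hn0 : (0 : ℝ) < n := by exact_mod_cast (NeZero.pos n)
  have hm0 : (0 : ℝ) < m := by exact_mod_cast hm
  have hmn' : 2 * (m : ℝ) ≤ n := by exact_mod_cast hmn
  have hδ2 : 2 * n * δ ≤ m := by
    rw [le_div_iff₀ (by positivity)] at hδm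
    linarith
  refine (ENNReal.ofReal_le_ofReal ?_).trans
    ((stdDesign n m hm).riskPerm_ge hlam h𝒩 hδ (fun i => ?_) hη hq hsum)
  · have hp : (n : ℝ) ≤ 4 * ((stdDesign n m hm).pairs.card : ℝ) := by
      exact_mod_cast le_four_mul_card_pairs hm hmn
    have : (n : ℝ) * (d * δ ^ 2 * q) ≤ 4 * ((stdDesign n m hm).pairs.card : ℝ) * (d * δ ^ 2 * q) :=
      mul_le_mul_of_nonneg_right hp (by positivity)
    linarith
  · have h1 : (((stdDesign n m hm).group i : ℕ) : ℝ) ≤ n / (2 * m) := by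
      rw [le_div_iff₀ (by positivity)]
      have : (i : ℕ) / (2 * m) * (2 * m) ≤ n := (Nat.div_mul_le_self _ _).trans i.2.le
      exact_mod_cast this
    have h2 : 2 * δ * (((stdDesign n m hm).group i : ℕ) : ℝ) ≤ 2 * δ * (n / (2 * m)) :=
      mul_le_mul_of_nonneg_left h1 (by linarith)
    have h3 : 2 * δ * (n / (2 * m)) ≤ 1 / 2 := by
      rw [← mul_div_assoc, div_le_iff₀ (by positivity)]
      linarith
    have h4 : δ ≤ 1 / 2 := by
      refine hδm.trans ?_
      rw [div_le_iff₀ (by positivity)]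
      linarith
    linarith

/-- Every block is active (`q = 1`) and groups are as large as possible, `m = n / 2 ≥ n / 3`. With
`d * lam * δ ^ 2 = 1 / 36` the flip is undetectable, and `lam ≥ 1 / d` gives `δ ≤ 1 / 6 ≤ m / (2 *
n)`. -/
theorem riskPerm_ge_div [NeZero d] (hn : 2 ≤ n) {lam : ℝ} (hlam : 1 / d ≤ lam)
    {𝒩 : Set (NoiseFamily n d)} (h𝒩 : stdNoise n d ∈ 𝒩) :
    ENNReal.ofReal (n / lam / 2304) ≤ riskPerm n d lam 𝒩 := by
  have : NeZero n := ⟨by omega⟩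
  have hd : (0 : ℝ) < d := by exact_mod_cast (NeZero.pos d)
  have hd1 : (1 : ℝ) ≤ d := by exact_mod_cast (NeZero.pos d)
  have hl : 0 < lam := lt_of_lt_of_le (by positivity) hlam
  have hdl : 1 ≤ d * lam := by
    rw [div_le_iff₀ hd] at hlam
    linarith
  have hs1 : 1 ≤ √(d * lam) := Real.one_le_sqrt.2 hdl
  have hsq : √(d * lam) ^ 2 = d * lam := Real.sq_sqrt (by positivity)
  set δ : ℝ := 1 / (6 * √(d * lam)) with hδ
  have hδ2 : d * lam * δ ^ 2 = 1 / 36 := by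
    rw [hδ, div_pow, mul_pow, hsq]
    field_simp
    norm_num
  have hδ0 : 0 ≤ δ := by positivity
  have hlδ : lam * δ ^ 2 ≤ 1 / 36 := by
    rw [← hδ2]
    have : 0 ≤ lam * δ ^ 2 := by positivity
    nlinarith
  have hδ6 : δ ≤ 1 / 6 := by
    rw [hδ]
    exact one_div_le_one_div_of_le (by norm_num) (by linarith)
  have hm3 : (n : ℝ) ≤ 3 * ((n / 2 : ℕ) : ℝ) := by
    have : n ≤ 3 * (n / 2) := by omega
    exact_mod_cast this
  have h := riskPerm_ge_of_groups (n := n) (d := d) hl.le h𝒩 (m := n / 2) (by omega) (by omega)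
    (δ := δ) hδ0 (by
      rw [le_div_iff₀ (by positivity)]
      have : (0 : ℝ) < n := by positivity
      nlinarith) (q := 1)
    (η := lam * δ ^ 2 / 4) (by positivity) (Or.inl ⟨rfl, le_rfl⟩) (by nlinarith)
  refine (ENNReal.ofReal_le_ofReal (le_of_eq ?_)).trans h
  have : d * δ ^ 2 = 1 / (36 * lam) := by
    rw [eq_div_iff (by positivity)]
    linarith
  rw [mul_one, mul_assoc, this]
  field_simp
  norm_num

theorem riskPerm_ge_mixture [NeZero d] {lam : ℝ} (hl : 0 < lam) {𝒩 : Set (NoiseFamily n d)}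
    (h𝒩 : stdNoise n d ∈ 𝒩) {m : ℕ} (hm : 1 ≤ m) (hmn : 2 * m ≤ n) {δ : ℝ} (hδ0 : 0 < δ)
    (hδm : δ ≤ m / (2 * n)) (hml : m * lam * δ ^ 2 ≤ 1 / 64) (hδd : 1 / 2 ≤ δ * √(lam * d)) :
    ENNReal.ofReal (n * δ * √(d / lam) / 256) ≤ riskPerm n d lam 𝒩 := by
  have : NeZero n := ⟨by omega⟩
  have hd : (0 : ℝ) < d := by exact_mod_cast (NeZero.pos d)
  have hn0 : (0 : ℝ) < n := by exact_mod_cast (NeZero.pos n)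
  have hm1 : (1 : ℝ) ≤ m := by exact_mod_cast hm
  have hmn' : 2 * (m : ℝ) ≤ n := by exact_mod_cast hmn
  have hs0 : 0 < √(lam * d) := Real.sqrt_pos.2 (by positivity)
  have hsq : √(lam * d) ^ 2 = lam * d := Real.sq_sqrt (by positivity)
  have hδ1 : δ ≤ 1 / 2 := by
    refine hδm.trans ?_
    rw [div_le_iff₀ (by positivity)]
    linarith
  have hδsq : δ ^ 2 ≤ 1 := by nlinarith
  set y := lam * (Real.exp (δ ^ 2) - 1) with hy
  have hexp : ∀ x : ℝ, 0 ≤ x → x ≤ 1 → Real.exp x - 1 ≤ 2 * x := by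
    intro x h0 h1
    have := Real.abs_exp_sub_one_le (x := x) (by rwa [abs_of_nonneg h0])
    rw [abs_of_nonneg h0] at this
    exact (le_abs_self _).trans this
  have hy0 : 0 ≤ y := mul_nonneg hl.le (by linarith [Real.one_le_exp (sq_nonneg δ)])
  have hy2 : y ≤ 2 * (lam * δ ^ 2) := by
    have := mul_le_mul_of_nonneg_left (hexp _ (sq_nonneg δ) hδsq) hl.le
    linarith
  have hlδ0 : 0 ≤ lam * δ ^ 2 := by positivity
  have hlδ : lam * δ ^ 2 ≤ 1 / 64 := by nlinarith
  have hmy : m * y ≤ 1 / 32 := by nlinarith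
  have hκm : Real.exp y ^ m ≤ 2 := by
    rw [← Real.exp_nat_mul]
    have := hexp (m * y) (by positivity) (by linarith)
    linarith
  have hκ : Real.exp y - 1 ≤ 4 * (lam * δ ^ 2) := by
    have := hexp y hy0 (by linarith)
    linarith
  have hκ0 : 0 ≤ Real.exp y - 1 := by linarith [Real.one_le_exp hy0]
  -- Chosen so that the `d` mixed blocks, each losing at most `η = 4 * q ^ 2 * (lam * δ ^ 2)`, lose
  -- `1 / 4` in total. The hypothesis `hδd` is exactly `q ≤ 1 / 2`.
  set q : ℝ := 1 / (4 * (δ * √(lam * d))) with hq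
  have hq0 : 0 ≤ q := by positivity
  have hqh : q ≤ 1 / 2 := by
    rw [hq]
    exact one_div_le_one_div_of_le (by norm_num) (by linarith)
  have hq2 : q ^ 2 * (lam * d * δ ^ 2) = 1 / 16 := by
    rw [hq, div_pow, mul_pow, mul_pow, hsq]
    field_simp
    norm_num
  have h := riskPerm_ge_of_groups (n := n) (d := d) hl.le h𝒩 hm hmn hδ0.le hδm (q := q)
    (η := 4 * q ^ 2 * (lam * δ ^ 2)) (by positivity) (Or.inr ⟨hq0, hqh, by
      have h1 : Real.exp y ^ m * (Real.exp y - 1) ≤ 2 * (4 * (lam * δ ^ 2)) :=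
        mul_le_mul hκm hκ hκ0 (by norm_num)
      have := mul_le_mul_of_nonneg_left h1 (sq_nonneg q)
      linarith⟩) (by
      have : (d : ℝ) * (4 * q ^ 2 * (lam * δ ^ 2)) = 1 / 4 := by linarith
      linarith)
  refine (ENNReal.ofReal_le_ofReal (le_of_eq ?_)).trans h
  have hsd : √(d / lam) = d / √(lam * d) := by
    rw [eq_div_iff hs0.ne', ← Real.sqrt_mul (by positivity)]
    rw [show d / lam * (lam * d) = (d : ℝ) ^ 2 by field_simp]
    exact Real.sqrt_sq hd.le
  rw [hsd, hq]
  field_simp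
  norm_num

/-- The factor by which the rate falls short of `n √(d / lam)`. -/
noncomputable def rateFactor (n : ℕ) (lam : ℝ) : ℝ := min ((n * lam) ^ (-(1 / 3) : ℝ)) 1

theorem rateFactor_pow_le (hn : 1 ≤ n) {lam : ℝ} (hl : 0 < lam) :
    rateFactor n lam ^ 3 * (n * lam) ≤ 1 := by
  have hn0 : (0 : ℝ) < n := by exact_mod_cast hn
  have h0 : 0 ≤ rateFactor n lam := le_min (by positivity) zero_le_one
  have h1 : rateFactor n lam ^ 3 ≤ ((n * lam) ^ (-(1 / 3) : ℝ)) ^ 3 :=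
    pow_le_pow_left₀ h0 (min_le_left _ _) 3
  have h2 : (((n : ℝ) * lam) ^ (-(1 / 3) : ℝ)) ^ 3 = (n * lam)⁻¹ := by
    rw [← Real.rpow_natCast, ← Real.rpow_mul (by positivity), ← Real.rpow_neg_one]
    norm_num
  rw [h2] at h1
  have := mul_le_mul_of_nonneg_right h1 (show (0 : ℝ) ≤ n * lam by positivity)
  rwa [inv_mul_cancel₀ (by positivity)] at this

/-- This is where `lam ≤ 8 * n ^ 2` enters: `n * lam ≤ (2 * n) ^ 3`. It lets groups with `m = 1`
still satisfy `m ≤ 2 * (n * v)`. -/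
theorem one_le_two_mul_rateFactor (hn : 1 ≤ n) {lam : ℝ} (hl : 0 < lam)
    (hl2 : lam ≤ 8 * (n : ℝ) ^ 2) : 1 ≤ 2 * (n * rateFactor n lam) := by
  have hn0 : (0 : ℝ) < n := by exact_mod_cast hn
  have hn1 : (1 : ℝ) ≤ n := by exact_mod_cast hn
  have h1 : 1 / (2 * (n : ℝ)) ≤ rateFactor n lam := by
    refine le_min ?_ ?_
    · have h2 : (n : ℝ) * lam ≤ (2 * n) ^ 3 := by nlinarith
      have h3 := Real.rpow_le_rpow_of_nonpos (by positivity) h2 (show (-(1 / 3) : ℝ) ≤ 0 by norm_num)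
      refine le_trans (le_of_eq ?_) h3
      rw [← Real.rpow_natCast, ← Real.rpow_mul (by positivity)]
      norm_num [Real.rpow_neg_one]
    · rw [div_le_one (by positivity)]
      linarith
  rw [div_le_iff₀ (by positivity)] at h1
  linarith

theorem rhoPerm_eq (hn : 1 ≤ n) {lam : ℝ} (hl : 0 < lam) :
    rhoPerm n d lam = n * √(d / lam) * rateFactor n lam + n / lam := by
  have hn0 : (0 : ℝ) < n := by exact_mod_cast hn
  have h : (n : ℝ) ^ (2 / 3 : ℝ) * √(d : ℝ) / lam ^ (5 / 6 : ℝ)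
      = n * √(d / lam) * (n * lam) ^ (-(1 / 3) : ℝ) := by
    rw [Real.sqrt_div (Nat.cast_nonneg d), Real.mul_rpow hn0.le hl.le, Real.sqrt_eq_rpow lam]
    have e1 : (n : ℝ) ^ (2 / 3 : ℝ) = n * (n : ℝ) ^ (-(1 / 3) : ℝ) := by
      rw [← Real.rpow_one_add' hn0.le (by norm_num)]
      norm_num
    have e2 : lam ^ (5 / 6 : ℝ) = lam ^ (1 / 2 : ℝ) * (lam ^ (-(1 / 3) : ℝ))⁻¹ := by
      rw [← Real.rpow_neg hl.le, ← Real.rpow_add hl]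
      norm_num
    rw [e1, e2]
    field_simp
  rw [rhoPerm, h, rateFactor, mul_min_of_nonneg _ _ (by positivity), mul_one]

theorem rhoPerm_le_riskPerm (hn : 2 ≤ n) (hd : 1 ≤ d) {lam : ℝ}
    (hlam : lam ∈ Set.Icc (1 / (d : ℝ)) (8 * (n : ℝ) ^ 2)) {𝒩 : Set (NoiseFamily n d)}
    (h𝒩 : stdNoise n d ∈ 𝒩) :
    ENNReal.ofReal (1 / 20736 * rhoPerm n d lam) ≤ riskPerm n d lam 𝒩 := by
  obtain ⟨hl1, hl2⟩ := hlam
  have : NeZero d := ⟨by omega⟩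
  have hd0 : (0 : ℝ) < d := by exact_mod_cast hd
  have hn0 : (0 : ℝ) < n := by positivity
  have hn2 : (2 : ℝ) ≤ n := by exact_mod_cast hn
  have hl : 0 < lam := lt_of_lt_of_le (by positivity) hl1
  have hdiv := riskPerm_ge_div hn hl1 h𝒩
  have hv3 := rateFactor_pow_le (n := n) (by omega) hl
  have hv1 := one_le_two_mul_rateFactor (n := n) (by omega) hl hl2
  have hvle : rateFactor n lam ≤ 1 := min_le_right _ _
  rw [rhoPerm_eq (by omega) hl]
  set v := rateFactor n lam with hv
  have hv0 : 0 < v := by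
    by_contra h
    nlinarith
  by_cases hcase : 1 / 2 ≤ v / 16 * √(lam * d)
  -- `m` lies between `n * v / 4` and `2 * n * v`. With `δ = v / 16` the lower bound gives `δ ≤ m /
  -- (2 * n)`, and the upper one gives `m * lam * δ ^ 2 ≤ n * lam * v ^ 3 / 128`.
  · set m : ℕ := max 1 ⌊n * v / 2⌋₊ with hm
    have hm1 : 1 ≤ m := le_max_left _ _
    have hfl : (⌊n * v / 2⌋₊ : ℝ) ≤ n * v / 2 := Nat.floor_le (by positivity)
    have hmle : (m : ℝ) ≤ 2 * (n * v) := by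
      rw [hm, Nat.cast_max]
      refine max_le ?_ ?_
      · exact_mod_cast hv1
      · linarith [mul_pos hn0 hv0]
    have hmn : 2 * m ≤ n := by
      have : (m : ℝ) ≤ n / 2 := by
        rw [hm, Nat.cast_max]
        refine max_le ?_ ?_
        · push_cast
          linarith
        · nlinarith
      have : 2 * (m : ℝ) ≤ n := by linarith
      exact_mod_cast this
    have hmge : n * v / 4 ≤ m := by
      have h1 : n * v / 2 < ⌊n * v / 2⌋₊ + 1 := Nat.lt_floor_add_one _
      have h2 : (⌊n * v / 2⌋₊ : ℝ) ≤ m := by exact_mod_cast le_max_right _ _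
      have h3 : (1 : ℝ) ≤ m := by exact_mod_cast hm1
      linarith
    have hmix := riskPerm_ge_mixture hl h𝒩 hm1 hmn (δ := v / 16) (by positivity) (by
        rw [le_div_iff₀ (by positivity)]
        have := mul_pos hn0 hv0
        linarith) (by
        have := mul_le_mul_of_nonneg_right hmle (show 0 ≤ lam * (v / 16) ^ 2 by positivity)
        nlinarith) hcase
    rcases le_total (n * √(d / lam) * v) (n / lam) with h | h
    · refine (ENNReal.ofReal_le_ofReal ?_).trans hdiv
      have : 0 < n / lam := by positivity
      linarith
    · refine (ENNReal.ofReal_le_ofReal ?_).trans hmix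
      have : 0 < n / lam := by positivity
      linarith
  -- Here `v * √(lam * d) < 8`, so the first term of the rate is at most `8 * (n / lam)` and the
  -- whole rate at most `9 * (n / lam)`; the constant is `20736 = 9 * 2304`.
  · refine (ENNReal.ofReal_le_ofReal ?_).trans hdiv
    have e : √(d / lam) = √(lam * d) / lam := by
      rw [eq_div_iff hl.ne']
      nth_rewrite 2 [← Real.sqrt_sq hl.le]
      rw [← Real.sqrt_mul (by positivity)]
      congr 1
      field_simp
    have h1 : v * √(lam * d) ≤ 8 := by linarith
    have h2 : n * √(d / lam) * v ≤ 8 * (n / lam) := by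
      rw [e, show n * (√(lam * d) / lam) * v = (v * √(lam * d)) * (n / lam) by ring]
      exact mul_le_mul_of_nonneg_right h1 (by positivity)
    linarith

theorem stdNoise_mem_subGaussianNoise : stdNoise n d ∈ subGaussianNoise n d := by
  intro x
  refine ⟨inferInstance, integral_id_gaussianReal, fun t => integrable_exp_mul_gaussianReal t,
    fun t => ?_⟩
  rw [mgf_id_gaussianReal]
  simp

end

end IsoPerm

theorem theorem1 :
    ∃ c : ℝ, 0 < c ∧ ∀ (n d : ℕ) (lam : ℝ), 2 ≤ n → 1 ≤ d →
      lam ∈ Set.Icc (1 / (d : ℝ)) (8 * (n : ℝ) ^ 2) →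
        ENNReal.ofReal (c * IsoPerm.rhoPerm n d lam)
            ≤ IsoPerm.riskPerm n d lam (IsoPerm.gaussianNoise n d) ∧
        ENNReal.ofReal (c * IsoPerm.rhoPerm n d lam)
            ≤ IsoPerm.riskPerm n d lam (IsoPerm.subGaussianNoise n d) :=
  ⟨1 / 20736, by norm_num, fun _ _ _ hn hd hlam =>
    ⟨IsoPerm.rhoPerm_le_riskPerm hn hd hlam rfl,
      IsoPerm.rhoPerm_le_riskPerm hn hd hlam IsoPerm.stdNoise_mem_subGaussianNoise⟩⟩
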